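/- **Setting.** Let $\{\mathcal M_c\}_{c\in C}$ be episodic MDPs with common state space $\mathcal S$, action space $\mathcal A$, horizon $H$ and initial state $x_1$, with transition kernels $P_{c,h}$ and random rewards $r_{c,h}\in[0,1]$, and let $c$ be drawn from a probability distribution on $C$. Write $V_{\mathcal M,1}^\pi(x_1)$ for the expected total reward of a Markovian policy $\pi$ in $\mathcal M$, $V_{c,1}^\pi=V_{\mathcal M_c,1}^\pi$, and $$\mathrm{SubOpt}(\pi)=\sup_{\pi'}\mathbb E_{c}V_{c,1}^{\pi'}(x_1)-\mathbb E_{c}V_{c,1}^{\pi}(x_1)$$ for the zero-shot generalization gap, suprema being over Markovian policies. A dataset $\bar{\mathcal D}=\{(x_h^\tau,a_h^\tau,r_h^\tau)_{h=1}^H\}_{\tau=1}^K$ without context labels consists of $K$ i.i.d. trajectories, each obtained by drawing $c$, running a fixed behavior policy $\bar\pi$ in $\mathcal M_c$, and discarding $c$. Let $\mu_{c,h}$ be the law (density) of $(s_h,a_h)$ under $\bar\pi$ in $\mathcal M_c$. The average MDP $\bar{\mathcal M}$ has $$\bar P_h(x'|x,a)=\mathbb E_c\frac{P_{c,h}(x'|x,a)\,\mu_{c,h}(x,a)}{\mathbb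 E_c\mu_{c,h}(x,a)},\qquad \mathbb P(\bar r_h=r|x,a)=\mathbb E_c\frac{\mathbb P(r_{c,h}=r|x,a)\,\mu_{c,h}(x,a)}{\mathbb E_c\mu_{c,h}(x,a)}$$ wherever $\mathbb E_c\mu_{c,h}(x,a)\neq 0$ (almost everywhere, when $\mu_{c,h}$ are densities); elsewhere it is arbitrary. Let $\phi:\mathcal S\times\mathcal A\to\mathbb R^d$ be measurable with $\|\phi\|\le 1$. An episodic MDP is linear with feature map $\phi$ if, for each $h\in[H]$, $P_h(x'|x,a)=\langle\phi(x,a),\mu_h(x')\rangle$ for some vector $\mu_h$ of $d$ signed measures on $\mathcal S$ with $\int_{\mathcal S}\|\mu_h(x)\|\,dx\le\sqrt d$, and $\mathbb E[r_h|x,a]=\langle\phi(x,a),\theta_h\rangle$ for some $\|\theta_h\|\le\sqrt d$. The policy $\bar\pi$ well-explores such an MDP with constant $c>0$ if $\lambda_{\min}\big(\mathbb E_{\bar\pi}[\phi(s_h,a_h)\phi(s_h,a_h)^\top]\big)\ge c/d$ in it for all $h\in[H]$. PEVI with parameters $\lambda,\beta$ sets $\hat V_{H+1}=0$ and, for $h=H,\dots,1$,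 $\Lambda_h=\sum_\tau\phi(x_h^\tau,a_h^\tau)\phi(x_h^\tau,a_h^\tau)^\top+\lambda I$, $\hat w_h=\Lambda_h^{-1}\sum_\tau\phi(x_h^\tau,a_h^\tau)\big(r_h^\tau+\hat V_{h+1}(x_{h+1}^\tau)\big)$, $\hat Q_h=\max\{\min\{\phi^\top\hat w_h-\beta(\phi^\top\Lambda_h^{-1}\phi)^{1/2},\,H-h+1\},0\}$, lets $\hat\pi_h(\cdot|x)$ be a maximizer of $\langle\hat Q_h(x,\cdot),\cdot\rangle$ over distributions on $\mathcal A$, and $\hat V_h(x)=\langle\hat Q_h(x,\cdot),\hat\pi_h(\cdot|x)\rangle$. It returns $\pi^{\mathrm{PEVI}}=\{\hat\pi_h\}_{h=1}^H$. **Theorem.** For every $c>0$ there is $\tilde c>0$ depending only on $c$, and for every $c'>0$ there is $c''>0$ depending only on $c$ and $c'$, such that the following holds. Suppose that the average MDP $\bar{\mathcal M}$ is linear with feature map $\phi$ and is well-explored by $\bar\pi$ with constant $c$. Let $\delta\in(0,1)$ and $K\ge\tilde c\, d\log(4dH/\delta)$, and run PEVI on $\bar{\mathcal D}$ with $\lambda=1$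 and $\beta=c'dH\sqrt{\log(4dHK/\delta)}$. Then, with probability at least $1-\delta$, $$\sup_\pi V_{\bar{\mathcal M},1}^{\pi}(x_1)-V_{\bar{\mathcal M},1}^{\pi^{\mathrm{PEVI}}}(x_1)\le c''\,d^{3/2}H^2K^{-1/2}\sqrt{\log(4dHK/\delta)}$$ and $$\mathrm{SubOpt}(\pi^{\mathrm{PEVI}})\le c''\,d^{3/2}H^2K^{-1/2}\sqrt{\log(4dHK/\delta)}+2\sup_\pi\big|V_{\bar{\mathcal M},1}^{\pi}(x_1)-\mathbb E_cV_{c,1}^{\pi}(x_1)\big|.$$ -/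

import Mathlib

open MeasureTheory ProbabilityTheory

namespace OfflineRL

noncomputable section

/-! Stages are numbered `0, 1, …, H - 1`.  Kernels are given for every natural number, but for an
episode of length `H` only the stages `h < H` are ever used. -/

/-- What is recorded at one stage: state, action, reward in `[0, 1]`, next state. -/
abbrev Transition (S A : Type*) := S × A × unitInterval × S

/-- A trajectory of `n` stages. -/
abbrev Trajectory (S A : Type*) (n : ℕ) := Fin n → Transition S A

/-- A dataset of `K` trajectories with `H` stages each, without any context information. -/
abbrev Dataset (S A : Type*) (K H : ℕ) := Fin K → Trajectory S A H

/-- A Markovian policy: at each stage, a map from states to distributions over actions. -/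
structure Policy (S A : Type*) [MeasurableSpace S] [MeasurableSpace A] where
  act : ℕ → Kernel S A
  markov : ∀ h, IsMarkovKernel (act h)

/-- An episodic MDP with transition kernels `P` and random rewards with law `R` on `[0, 1]`. -/
structure MDP (S A : Type*) [MeasurableSpace S] [MeasurableSpace A] where
  P : ℕ → Kernel (S × A) S
  R : ℕ → Kernel (S × A) unitInterval
  markovP : ∀ h, IsMarkovKernel (P h)
  markovR : ∀ h, IsMarkovKernel (R h)

/-- A contextual MDP: a family of episodic MDPs, measurable in the context. -/
structure ContextualMDP (C S A : Type*) [MeasurableSpace C] [MeasurableSpace S]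
    [MeasurableSpace A] where
  P : ℕ → Kernel (C × S × A) S
  R : ℕ → Kernel (C × S × A) unitInterval
  markovP : ∀ h, IsMarkovKernel (P h)
  markovR : ∀ h, IsMarkovKernel (R h)

attribute [instance] Policy.markov MDP.markovP MDP.markovR ContextualMDP.markovP
  ContextualMDP.markovR

variable {C S A : Type*} [MeasurableSpace C] [MeasurableSpace S] [MeasurableSpace A]

/-- Prepends the record of one stage to the trajectory of the remaining stages. -/
def consStep {n : ℕ} (z : S × A × unitInterval × S × Trajectory S A n) : Trajectory S A (n + 1) :=
  Fin.cons (z.1, z.2.1, z.2.2.1, z.2.2.2.1) z.2.2.2.2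

lemma measurable_consStep {n : ℕ} :
    Measurable (consStep : S × A × unitInterval × S × Trajectory S A n → _) := by
  refine measurable_pi_lambda _ fun i => ?_
  refine Fin.cases ?_ (fun j => ?_) i
  · simp only [consStep, Fin.cons_zero]
    fun_prop
  · simp only [consStep, Fin.cons_succ]
    fun_prop

/-- The law of the `n` stages `h, …, h + n - 1` when the policy `π` is run in `M` from the given
state at stage `h`: draw `a ∼ π_h(x)`, then independently `r ∼ R_h(x, a)` and `x' ∼ P_h(x, a)`,
record `(x, a, r, x')`, and continue from `x'` at stage `h + 1`. -/
def MDP.traj (M : MDP S A) (π : Policy S A) : (n h : ℕ) → Kernel S (Trajectory S A n)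
  | 0, _ => Kernel.const S (Measure.dirac fun i => i.elim0)
  | n + 1, h =>
    (Kernel.id ×ₖ (π.act h ⊗ₖ (M.R h ×ₖ (M.P h ⊗ₖ
      (M.traj π n (h + 1)).prodMkLeft (S × A))))).map consStep

instance MDP.isMarkovKernel_traj (M : MDP S A) (π : Policy S A) (n h : ℕ) :
    IsMarkovKernel (M.traj π n h) := by
  induction n generalizing h with
  | zero => unfold MDP.traj; infer_instance
  | succ n ih =>
    have := ih (h + 1)
    unfold MDP.traj
    exact Kernel.IsMarkovKernel.map _ measurable_consStep

/-- The expected total reward of the `n` stages `h, …, h + n - 1` under `π` from state `x` at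
stage `h`; in an episode of length `H` the value function of stage `h` is `M.value π (H - h) h`,
and that of the first stage is `M.value π H 0`. -/
def MDP.value (M : MDP S A) (π : Policy S A) (n h : ℕ) (x : S) : ℝ :=
  ∫ ω, ∑ i : Fin n, ((ω i).2.2.1 : ℝ) ∂(M.traj π n h x)

/-- The distribution of `(s_h, a_h)` when `π` is run in `M` from the initial state `x₁`. -/
def MDP.occupancy (M : MDP S A) (π : Policy S A) {H : ℕ} (x₁ : S) (h : Fin H) : Measure (S × A) :=
  (M.traj π H 0 x₁).map fun ω => ((ω h).1, (ω h).2.1)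

/-- The episodic MDP of the context `c`. -/
def ContextualMDP.mdp (M : ContextualMDP C S A) (c : C) : MDP S A where
  P h := (M.P h).sectR c
  R h := (M.R h).sectR c
  markovP _ := inferInstance
  markovR _ := inferInstance

private lemma compProd_congr_apply {X X' Y Z : Type*} [MeasurableSpace X] [MeasurableSpace X']
    [MeasurableSpace Y] [MeasurableSpace Z] {κ : Kernel X Y} {κ' : Kernel X' Y}
    {η : Kernel (X × Y) Z} {η' : Kernel (X' × Y) Z} [IsSFiniteKernel κ] [IsSFiniteKernel κ']
    [IsSFiniteKernel η] [IsSFiniteKernel η'] {x : X} {x' : X'} (h : κ x = κ' x')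
    (h' : ∀ y, η (x, y) = η' (x', y)) : (κ ⊗ₖ η) x = (κ' ⊗ₖ η') x' := by
  ext s hs
  rw [Kernel.compProd_apply hs, Kernel.compProd_apply hs, h]
  simp only [h']

/-- The trajectory law of a context depends measurably on the context. -/
lemma ContextualMDP.measurable_traj (M : ContextualMDP C S A) (π : Policy S A) (n h : ℕ) :
    Measurable fun q : C × S => (M.mdp q.1).traj π n h q.2 := by
  suffices H : ∃ κ : Kernel (C × S) (Trajectory S A n), IsMarkovKernel κ ∧
      ∀ q, κ q = (M.mdp q.1).traj π n h q.2 by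
    obtain ⟨κ, -, hκ⟩ := H
    simpa only [← hκ] using κ.measurable
  induction n generalizing h with
  | zero => exact ⟨Kernel.const _ (Measure.dirac fun i => i.elim0), inferInstance, fun _ => rfl⟩
  | succ n ih =>
    obtain ⟨κ, hκ, hκq⟩ := ih (h + 1)
    have hf : Measurable fun w : (C × S) × A => (w.1.1, w.1.2, w.2) := by fun_prop
    have hg : Measurable fun w : ((C × S) × A) × S => (w.1.1.1, w.2) := by fun_prop
    refine ⟨(Kernel.deterministic Prod.snd measurable_snd ×ₖ ((π.act h).prodMkLeft C ⊗ₖ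
      ((M.R h).comap _ hf ×ₖ ((M.P h).comap _ hf ⊗ₖ κ.comap _ hg)))).map consStep,
      Kernel.IsMarkovKernel.map _ measurable_consStep, fun q => ?_⟩
    rw [MDP.traj, Kernel.map_apply _ measurable_consStep, Kernel.map_apply _ measurable_consStep,
      Kernel.prod_apply, Kernel.prod_apply]
    congr 2
    refine compProd_congr_apply rfl fun a => ?_
    rw [Kernel.prod_apply, Kernel.prod_apply]
    congr 1
    exact compProd_congr_apply rfl fun x' => hκq (q.1, x')

/-- The law of one trajectory of the merged dataset: a context is drawn from `p`, the behavior
policy `π` is run in the MDP of this context, and the context is forgotten. -/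
def ContextualMDP.mergedLaw (M : ContextualMDP C S A) (p : Measure C) (π : Policy S A)
    (x₁ : S) (H : ℕ) : Measure (Trajectory S A H) :=
  p.bind fun c => (M.mdp c).traj π H 0 x₁

/-- The law of the merged dataset: `K` i.i.d. trajectories. -/
def ContextualMDP.datasetLaw (M : ContextualMDP C S A) (p : Measure C) (π : Policy S A)
    (x₁ : S) (K H : ℕ) : Measure (Dataset S A K H) :=
  Measure.pi fun _ => M.mergedLaw p π x₁ H

/-- `κ̄(· | z) = 𝔼_c [κ_c(· | z) μ_c(z)] / 𝔼_c [μ_c(z)]` wherever the denominator does not vanish.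
On a general space `μ_c(z)` is a density, and the identity, multiplied by its denominator, is
meant for almost every `z`; it is therefore written in integrated form. -/
def IsAverageKernel {Z Y : Type*} [MeasurableSpace Z] [MeasurableSpace Y] (p : Measure C)
    (μ : C → Measure Z) (κ : C → Kernel Z Y) (κbar : Kernel Z Y) : Prop :=
  ∀ (E : Set Z) (B : Set Y), MeasurableSet E → MeasurableSet B →
    ∫⁻ c, ∫⁻ z in E, κbar z B ∂(μ c) ∂p = ∫⁻ c, ∫⁻ z in E, κ c z B ∂(μ c) ∂p

/-- At the points of positive mass, `IsAverageKernel` is the quotient formula. -/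
lemma IsAverageKernel.apply_eq_div {Z Y : Type*} [MeasurableSpace Z] [MeasurableSingletonClass Z]
    [MeasurableSpace Y] {p : Measure C} [IsProbabilityMeasure p] {μ : C → Measure Z}
    [∀ c, IsProbabilityMeasure (μ c)] {κ : C → Kernel Z Y} {κbar : Kernel Z Y}
    (hκ : IsAverageKernel p μ κ κbar) (hμ : Measurable μ) (z : Z) (hz : ∫⁻ c, μ c {z} ∂p ≠ 0)
    {B : Set Y} (hB : MeasurableSet B) :
    κbar z B = (∫⁻ c, κ c z B * μ c {z} ∂p) / ∫⁻ c, μ c {z} ∂p := by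
  have h := hκ {z} B (measurableSet_singleton z) hB
  simp only [lintegral_singleton] at h
  have hm : Measurable fun c => μ c {z} :=
    (Measure.measurable_coe (measurableSet_singleton z)).comp hμ
  rw [lintegral_const_mul _ hm] at h
  have hfin : ∫⁻ c, μ c {z} ∂p ≠ ⊤ := by
    refine ne_top_of_le_ne_top ENNReal.one_ne_top ?_
    calc ∫⁻ c, μ c {z} ∂p ≤ ∫⁻ _, 1 ∂p := lintegral_mono fun c => prob_le_one
      _ = 1 := by simp
  rw [ENNReal.eq_div_iff hz hfin, mul_comm, h]

/-- `Mbar` is the average MDP of the contextual MDP `M` for the context distribution `p` and the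
data collected by `π`; at pairs `(x, a)` that no data can reach, any choice is admitted. -/
def ContextualMDP.IsAverage (M : ContextualMDP C S A) (p : Measure C) (π : Policy S A)
    (x₁ : S) (H : ℕ) (Mbar : MDP S A) : Prop :=
  ∀ h : Fin H,
    IsAverageKernel p (fun c => (M.mdp c).occupancy π x₁ h) (fun c => (M.mdp c).P h) (Mbar.P h) ∧
    IsAverageKernel p (fun c => (M.mdp c).occupancy π x₁ h) (fun c => (M.mdp c).R h) (Mbar.R h)

/-- The expected value over the contexts, at the first stage. -/
def ContextualMDP.meanValue (M : ContextualMDP C S A) (p : Measure C) (H : ℕ) (x₁ : S)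
    (π : Policy S A) : ℝ :=
  ∫ c, (M.mdp c).value π H 0 x₁ ∂p

/-- The zero-shot generalization gap of `π`. -/
def ContextualMDP.subOpt (M : ContextualMDP C S A) (p : Measure C) (H : ℕ) (x₁ : S)
    (π : Policy S A) : ℝ :=
  (⨆ π' : Policy S A, M.meanValue p H x₁ π') - M.meanValue p H x₁ π

variable {d K H : ℕ}

/-- `M` is a linear MDP with feature map `φ`: `P_h(· | x, a)` has the density `⟨φ(x, a), m(·)⟩`
with respect to a base measure `ν` (equivalently, `m ν` is a vector of `d` signed measures),
with `∫ ‖m‖ dν ≤ √d`, and the mean reward is `⟨φ(x, a), θ⟩`. -/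
def MDP.IsLinear (M : MDP S A) (H : ℕ) (φ : S × A → EuclideanSpace ℝ (Fin d)) : Prop :=
  Measurable φ ∧ (∀ z, ‖φ z‖ ≤ 1) ∧ ∀ h < H,
    (∃ (ν : Measure S) (m : S → EuclideanSpace ℝ (Fin d)),
      Integrable m ν ∧ ∫ x, ‖m x‖ ∂ν ≤ √(d : ℝ) ∧
      ∀ z B, MeasurableSet B → (M.P h z).real B = ∫ x in B, inner ℝ (φ z) (m x) ∂ν) ∧
    (∃ θ : EuclideanSpace ℝ (Fin d), ‖θ‖ ≤ √(d : ℝ) ∧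
      ∀ z, ∫ r, (r : ℝ) ∂(M.R h z) = inner ℝ (φ z) θ)

/-- `Σ_h = 𝔼_{π, M} [φ(s_h, a_h) φ(s_h, a_h)ᵀ]`. -/
def MDP.covariance (M : MDP S A) (π : Policy S A) (x₁ : S)
    (φ : S × A → EuclideanSpace ℝ (Fin d)) (h : Fin H) : Matrix (Fin d) (Fin d) ℝ :=
  Matrix.of fun i j => ∫ z, φ z i * φ z j ∂(M.occupancy π x₁ h)

/-- `π` well-explores the linear MDP `M` with constant `c`: `M` is linear with feature map `φ`, and
`λ_min(Σ_h) ≥ c / d` at every stage. -/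
def MDP.WellExplored (M : MDP S A) (π : Policy S A) (H : ℕ) (x₁ : S)
    (φ : S × A → EuclideanSpace ℝ (Fin d)) (c : ℝ) : Prop :=
  M.IsLinear H φ ∧
    ∀ h : Fin H, (M.covariance π x₁ φ h - (c / d) • (1 : Matrix (Fin d) (Fin d) ℝ)).PosSemidef

/-! Pessimistic value iteration -/

namespace PEVI

variable (φ : S × A → EuclideanSpace ℝ (Fin d)) (D : Dataset S A K H) (lam β : ℝ)

/-- The feature vector of the `τ`-th sample of stage `h`. -/
def feat (h : Fin H) (τ : Fin K) : Fin d → ℝ := (φ ((D τ h).1, (D τ h).2.1)).ofLp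

/-- `Λ_h = ∑_τ φ(x_h^τ, a_h^τ) φ(x_h^τ, a_h^τ)ᵀ + λ I`. -/
def gram (h : Fin H) : Matrix (Fin d) (Fin d) ℝ :=
  ∑ τ, Matrix.vecMulVec (feat φ D h τ) (feat φ D h τ) + lam • 1

/-- `ŵ_h = Λ_h⁻¹ ∑_τ φ(x_h^τ, a_h^τ) (r_h^τ + V(x_{h+1}^τ))`. -/
def weight (h : Fin H) (V : S → ℝ) : Fin d → ℝ :=
  (gram φ D lam h)⁻¹.mulVec
    (∑ τ, (((D τ h).2.2.1 : ℝ) + V (D τ h).2.2.2) • feat φ D h τ)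

/-- `Γ_h(x, a) = β (φ(x, a)ᵀ Λ_h⁻¹ φ(x, a))^{1/2}`. -/
def bonus (h : Fin H) (z : S × A) : ℝ :=
  β * √((φ z).ofLp ⬝ᵥ (gram φ D lam h)⁻¹.mulVec (φ z).ofLp)

/-- `Q̂_h = min {φᵀ ŵ_h - Γ_h, number of stages left}⁺`, where `V` stands for `V̂_{h+1}`. -/
def Q (h : Fin H) (V : S → ℝ) (z : S × A) : ℝ :=
  max (min ((φ z).ofLp ⬝ᵥ weight φ D lam h V - bonus φ D lam β h z) ((H : ℝ) - (h : ℕ))) 0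

/-- `π` is a policy that pessimistic value iteration returns on the dataset `D` (the maximizer in
the greedy step need not be unique); `V h` is the estimated value function of stage `h`. -/
def IsOutput (π : Policy S A) : Prop :=
  ∃ V : ℕ → S → ℝ, (∀ x, V H x = 0) ∧ ∀ h : Fin H, ∀ x,
    (∀ q : Measure A, IsProbabilityMeasure q →
      ∫ a, Q φ D lam β h (V (h + 1)) (x, a) ∂q
        ≤ ∫ a, Q φ D lam β h (V (h + 1)) (x, a) ∂(π.act h x)) ∧
    V h x = ∫ a, Q φ D lam β h (V (h + 1)) (x, a) ∂(π.act h x)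

end PEVI

end

end OfflineRL

open OfflineRL

namespace OfflineRL

noncomputable section

/-! At a fixed stage, a transition of the merged data looks like a transition of the average MDP.
Mixing the trajectory laws over the contexts weights the kernel of context `c` by its occupancy
`μ_c`, and this is exactly the average that defines `Mbar` (`IsAverageKernel.lintegral_bind_eq`). By
induction on the stage, the mixture and `Mbar` also have the same state-action law under the
behavior policy (`ContextualMDP.IsAverage.map_eq_occupancy`). A whole merged trajectory is not a
trajectory of `Mbar`: the forgotten context correlates the stages, and even the reward and the next
state of one stage. But PEVI solves one regression per stage over i.i.d. trajectories, so these
one-stage laws are all that matters.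

In a linear MDP the Bellman backup of a bounded `V` is `φᵀ w`, so the Bellman error of PEVI is that
of a ridge regression plus the bonus. In terms of `b = √(φᵀ Λ⁻¹ φ)` the regression error is at most
`b (8 H √L + √d H)`, provided that the noise in each direction `u` is at most `H (∑ (φᵀ u)² / 2 + 7
L)`. For fixed `u` and `V` this comes from a conditional exponential moment
(`ContextualMDP.IsAverage.lintegral_exp_tdError_le`). The estimated value of the next stage depends
on the same data, so the bound is made uniform over a net of all functions of the form PEVI can
produce. These are described by a vector and a `d × d` matrix, whence `L` of order `d² log (4 d H K
/ δ)`. Exploration and Hoeffding's inequality on a net of the unit sphere bound the empirical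
covariance below by `K c / (2 d)`, so that `b ≤ √(2 d / (K c))`.

All Bellman errors are then at most some `e` of order `d^{3/2} H K^{-1/2} √log`, and
`PEVI.value_sub_value_le` gives suboptimality at most `2 H e` in `Mbar`. The bonus is simply one
more error of this order; pessimism is not needed, which is why every `c' > 0` is allowed. The bound
for the contextual problem follows by the triangle inequality. If the claimed rate is at least `H`,
both bounds are trivial; otherwise `K` exceeds a multiple of `d³ log (4 d H K / δ)`, which is all
that the concentration steps ask for. -/

/-! ### Nets, union bound and Hoeffding's lemma -/

/-- A family of parameters in a box has a finite subfamily that is an `η`-net. -/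
lemma exists_finset_net {T ι : Type*} [Fintype ι] (θ : T → ι → ℝ) {B η : ℝ} (hB : 0 ≤ B)
    (hθ : ∀ t i, |θ t i| ≤ B) (hη : 0 < η) :
    ∃ F : Finset T, (F.card : ℝ) ≤ (2 * B / η + 2) ^ Fintype.card ι ∧
      ∀ t, ∃ t' ∈ F, ∀ i, |θ t i - θ t' i| ≤ η := by
  classical
  let g : T → ι → ℤ := fun t i => ⌊θ t i / η⌋
  let G : Finset (ι → ℤ) := Fintype.piFinset fun _ => Finset.Icc ⌊-(B / η)⌋ ⌊B / η⌋
  have hg : ∀ t, g t ∈ G := fun t => by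
    simp only [G, g, Fintype.mem_piFinset, Finset.mem_Icc]
    intro i
    have := abs_le.1 (hθ t i)
    constructor
    · apply Int.floor_le_floor
      rw [← neg_div]
      gcongr
      exact this.1
    · apply Int.floor_le_floor
      gcongr
      exact this.2
  -- One representative is chosen per occupied grid cell, so the net consists of members of the
  -- family itself: unit vectors, or genuine value functions.
  let s : Finset (ι → ℤ) := {y ∈ G | ∃ t, g t = y}
  have hs : ∀ y ∈ s, ∃ t, g t = y := fun y hy => (Finset.mem_filter.1 hy).2
  choose r hr using hs
  refine ⟨s.attach.image fun y => r y.1 y.2, ?_, fun t => ?_⟩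
  · have h1 : (s.attach.image fun y => r y.1 y.2).card ≤ G.card :=
      Finset.card_image_le.trans (by rw [Finset.card_attach]; exact Finset.card_filter_le _ _)
    have h2 : (G.card : ℝ) ≤ (2 * B / η + 2) ^ Fintype.card ι := by
      simp only [G, Fintype.card_piFinset, Finset.prod_const, Finset.card_univ, Int.card_Icc]
      push_cast
      have hBη : 0 ≤ B / η := by positivity
      have h3 : (0 : ℤ) ≤ ⌊B / η⌋ + 1 - ⌊-(B / η)⌋ := by
        have : ⌊-(B / η)⌋ ≤ ⌊B / η⌋ := Int.floor_le_floor (by linarith)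
        linarith
      have h4 : (((⌊B / η⌋ + 1 - ⌊-(B / η)⌋).toNat : ℕ) : ℝ) ≤ 2 * B / η + 2 := by
        rw [← Int.cast_natCast, Int.toNat_of_nonneg h3]
        push_cast
        have h5 := Int.floor_le (B / η)
        have h6 := Int.sub_one_lt_floor (-(B / η))
        rw [mul_div_assoc]
        linarith
      gcongr
    exact (Nat.cast_le.2 h1).trans h2
  · have ht : g t ∈ s := Finset.mem_filter.2 ⟨hg t, t, rfl⟩
    refine ⟨r _ ht, Finset.mem_image.2 ⟨⟨g t, ht⟩, Finset.mem_attach _ _, rfl⟩, fun i => ?_⟩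
    have h := congrFun (hr _ ht) i
    have := Int.abs_sub_lt_one_of_floor_eq_floor h
    rw [← sub_div, abs_div, abs_of_pos hη, div_lt_one hη, abs_sub_comm] at this
    exact this.le

lemma lintegral_pi_prod {Ω : Type*} [MeasurableSpace Ω] (μ : Measure Ω) [IsProbabilityMeasure μ]
    (K : ℕ) {f : Ω → ENNReal} (hf : Measurable f) :
    ∫⁻ D : Fin K → Ω, ∏ τ, f (D τ) ∂(Measure.pi fun _ => μ) = (∫⁻ ω, f ω ∂μ) ^ K := by
  have hind : iIndepFun (fun (τ : Fin K) (D : Fin K → Ω) => f (D τ)) (Measure.pi fun _ => μ) :=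
    iIndepFun_pi (X := fun _ => f) fun _ => hf.aemeasurable
  have h := lintegral_prod_eq_prod_lintegral_of_indepFun Finset.univ
    (fun (τ : Fin K) (D : Fin K → Ω) => f (D τ)) hind fun τ => hf.comp (measurable_pi_apply τ)
  rw [h]
  have (τ : Fin K) : ∫⁻ D : Fin K → Ω, f (D τ) ∂(Measure.pi fun _ => μ) = ∫⁻ ω, f ω ∂μ :=
    (measurePreserving_eval (fun _ : Fin K => μ) τ).lintegral_comp hf
  simp [this]

/-- Exponential Markov inequality and union bound for sums over an i.i.d. sample. -/
lemma exists_event_sum_le {Ω ι : Type*} [MeasurableSpace Ω] (μ : Measure Ω)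
    [IsProbabilityMeasure μ] (K : ℕ) (F : Finset ι) (f : ι → Ω → ℝ)
    (hf : ∀ i ∈ F, Measurable (f i))
    (hexp : ∀ i ∈ F, ∫⁻ ω, ENNReal.ofReal (Real.exp (f i ω)) ∂μ ≤ 1) {N δ : ℝ}
    (hN : (F.card : ℝ) ≤ N) (hN0 : 0 < N) (hδ : 0 < δ) :
    ∃ E : Set (Fin K → Ω), MeasurableSet E ∧
      (Measure.pi fun _ : Fin K => μ) Eᶜ ≤ ENNReal.ofReal δ ∧
      ∀ D ∈ E, ∀ i ∈ F, ∑ τ, f i (D τ) ≤ Real.log (N / δ) := by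
  let B : ι → Set (Fin K → Ω) := fun i => {D | Real.log (N / δ) < ∑ τ, f i (D τ)}
  have hmeas : ∀ i ∈ F, Measurable fun D : Fin K → Ω => ∑ τ, f i (D τ) := fun i hi =>
    Finset.measurable_sum _ fun τ _ => (hf i hi).comp (measurable_pi_apply τ)
  have hB : ∀ i ∈ F, MeasurableSet (B i) := fun i hi =>
    measurableSet_lt measurable_const (hmeas i hi)
  have hprob : ∀ i ∈ F, (Measure.pi fun _ : Fin K => μ) (B i) ≤ ENNReal.ofReal (δ / N) := by
    intro i hi
    have h1 : ∫⁻ D : Fin K → Ω, ENNReal.ofReal (Real.exp (∑ τ, f i (D τ)))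
        ∂(Measure.pi fun _ => μ) ≤ 1 := by
      have : ∀ D : Fin K → Ω, ENNReal.ofReal (Real.exp (∑ τ, f i (D τ))) =
          ∏ τ, ENNReal.ofReal (Real.exp (f i (D τ))) := fun D => by
        rw [Real.exp_sum, ENNReal.ofReal_prod_of_nonneg fun _ _ => (Real.exp_pos _).le]
      simp only [this]
      rw [lintegral_pi_prod μ K (f := fun ω => ENNReal.ofReal (Real.exp (f i ω)))
        (by have := hf i hi; fun_prop)]
      exact pow_le_one' (hexp i hi) _
    have h2 := mul_meas_ge_le_lintegral₀ (μ := Measure.pi fun _ : Fin K => μ)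
      (f := fun D => ENNReal.ofReal (Real.exp (∑ τ, f i (D τ))))
      (hmeas i hi).exp.ennreal_ofReal.aemeasurable (ENNReal.ofReal (N / δ))
    have h3 : (Measure.pi fun _ : Fin K => μ) (B i) ≤ (Measure.pi fun _ : Fin K => μ)
        {D | ENNReal.ofReal (N / δ) ≤ ENNReal.ofReal (Real.exp (∑ τ, f i (D τ)))} := by
      refine measure_mono fun D hD => ENNReal.ofReal_le_ofReal ?_
      rw [← Real.exp_log (x := N / δ) (by positivity)]
      exact Real.exp_le_exp.2 (le_of_lt hD)
    have h4 : ENNReal.ofReal (N / δ) * (Measure.pi fun _ : Fin K => μ) (B i) ≤ 1 :=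
      (mul_le_mul_right h3 _).trans (h2.trans h1)
    rw [← inv_div, ENNReal.ofReal_inv_of_pos (by positivity)]
    exact ENNReal.le_inv_iff_mul_le.2 (by rwa [mul_comm])
  refine ⟨(⋃ i ∈ F, B i)ᶜ, (F.measurableSet_biUnion hB).compl, ?_, fun D hD i hi => ?_⟩
  · rw [compl_compl]
    calc _ ≤ ∑ i ∈ F, (Measure.pi fun _ : Fin K => μ) (B i) := measure_biUnion_finset_le _ _
      _ ≤ ∑ i ∈ F, ENNReal.ofReal (δ / N) := Finset.sum_le_sum hprob
      _ = ENNReal.ofReal (F.card * (δ / N)) := by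
        rw [Finset.sum_const, nsmul_eq_mul, ENNReal.ofReal_mul (by positivity),
          ENNReal.ofReal_natCast]
      _ ≤ ENNReal.ofReal δ := by
        apply ENNReal.ofReal_le_ofReal
        rw [mul_div_assoc', div_le_iff₀ hN0, mul_comm]
        gcongr
  · by_contra h
    exact hD (Set.mem_biUnion hi (not_le.1 h))

/-- Hoeffding's lemma in terms of the Lebesgue integral. -/
lemma lintegral_exp_sub_integral_le {Ω : Type*} [MeasurableSpace Ω] (μ : Measure Ω)
    [IsProbabilityMeasure μ] {X : Ω → ℝ} (hX : Measurable X) {l : ℝ}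
    (h : ∀ ω, X ω ∈ Set.Icc 0 l) (t : ℝ) :
    ∫⁻ ω, ENNReal.ofReal (Real.exp (t * (X ω - ∫ ω', X ω' ∂μ) - t ^ 2 * l ^ 2 / 8)) ∂μ ≤ 1 := by
  have h1 := hasSubgaussianMGF_of_mem_Icc hX.aemeasurable (ae_of_all μ h)
  have h2 := h1.mgf_le t
  have h3 := h1.integrable_exp_mul t
  simp only [Real.exp_sub, div_eq_mul_inv, ENNReal.ofReal_mul (Real.exp_pos _).le]
  rw [lintegral_mul_const _ (by fun_prop),
    ← ofReal_integral_eq_lintegral_ofReal h3 (ae_of_all _ fun _ => (Real.exp_pos _).le),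
    ← ENNReal.ofReal_mul (integral_nonneg fun _ => (Real.exp_pos _).le), ← ENNReal.ofReal_one]
  apply ENNReal.ofReal_le_ofReal
  rw [← div_eq_mul_inv, div_le_one (Real.exp_pos _)]
  refine h2.trans_eq ?_
  congr 1
  -- The variance proxy in Hoeffding's lemma is `(l / 2) ^ 2`; half of it times `t ^ 2` is the
  -- subtracted term.
  simp [div_pow]
  ring

/-! ### One-stage marginals of the trajectory law -/

section Trajectories

variable {S A : Type*} [MeasurableSpace S] [MeasurableSpace A]

lemma MDP.lintegral_traj_succ (M : MDP S A) (π : Policy S A) (n h : ℕ) (x : S)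
    {f : Trajectory S A (n + 1) → ENNReal} (hf : Measurable f) :
    ∫⁻ ω, f ω ∂(M.traj π (n + 1) h x) =
      ∫⁻ a, ∫⁻ r, ∫⁻ x', ∫⁻ ω, f (consStep (x, a, r, x', ω)) ∂(M.traj π n (h + 1) x')
        ∂(M.P h (x, a)) ∂(M.R h (x, a)) ∂(π.act h x) := by
  -- An opaque name for `f ∘ consStep`, so that measurability of its sections is found from `hg`
  -- alone.
  obtain ⟨g, hg, hgf⟩ : ∃ g : S × A × unitInterval × S × Trajectory S A n → _,
    Measurable g ∧ ∀ z, f (consStep z) = g z := ⟨_, hf.comp measurable_consStep, fun _ => rfl⟩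
  rw [MDP.traj, Kernel.map_apply _ measurable_consStep, lintegral_map hf measurable_consStep]
  simp only [hgf]
  rw [Kernel.lintegral_id_prod hg, Kernel.lintegral_compProd _ _ _ (by fun_prop)]
  refine lintegral_congr fun a => ?_
  rw [Kernel.lintegral_prod _ _ _ (by fun_prop)]
  refine lintegral_congr fun r => ?_
  rw [Kernel.lintegral_compProd _ _ _ (by fun_prop)]
  simp

lemma MDP.integral_traj_succ (M : MDP S A) (π : Policy S A) (n h : ℕ) (x : S)
    {f : Trajectory S A (n + 1) → ℝ} (hf : Measurable f) {c : ℝ} (hc : ∀ ω, |f ω| ≤ c) :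
    ∫ ω, f ω ∂(M.traj π (n + 1) h x) =
      ∫ a, ∫ r, ∫ x', ∫ ω, f (consStep (x, a, r, x', ω)) ∂(M.traj π n (h + 1) x')
        ∂(M.P h (x, a)) ∂(M.R h (x, a)) ∂(π.act h x) := by
  obtain ⟨g, hg, hgf⟩ : ∃ g : S × A × unitInterval × S × Trajectory S A n → _,
    Measurable g ∧ ∀ z, f (consStep z) = g z := ⟨_, hf.comp measurable_consStep, fun _ => rfl⟩
  rw [MDP.traj, Kernel.map_apply _ measurable_consStep,
    integral_map measurable_consStep.aemeasurable hf.aestronglyMeasurable]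
  simp only [hgf]
  have hc' : ∀ z, |g z| ≤ c := fun z => hgf z ▸ hc _
  rw [Kernel.prod_apply, Kernel.id_apply, Measure.dirac_prod,
    integral_map (by fun_prop) hg.aestronglyMeasurable, ProbabilityTheory.integral_compProd]
  swap
  · exact Integrable.of_bound (Measurable.aestronglyMeasurable (by fun_prop)) c
      (ae_of_all _ fun _ => hc' _)
  congr 1
  ext a
  rw [Kernel.prod_apply, integral_prod]
  swap
  · exact Integrable.of_bound (Measurable.aestronglyMeasurable (by fun_prop)) c
      (ae_of_all _ fun _ => hc' _)
  congr 1
  ext r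
  rw [ProbabilityTheory.integral_compProd]
  swap
  · exact Integrable.of_bound (Measurable.aestronglyMeasurable (by fun_prop)) c
      (ae_of_all _ fun _ => hc' _)
  simp

/-- One transition of the state process. -/
def MDP.stateStep (M : MDP S A) (π : Policy S A) (h : ℕ) : Kernel S S :=
  (π.act h ⊗ₖ M.P h).snd

/-- The law of the state `i` stages after stage `h`. -/
def MDP.stateLaw (M : MDP S A) (π : Policy S A) : (i h : ℕ) → Kernel S S
  | 0, _ => Kernel.id
  | i + 1, h => M.stateLaw π i (h + 1) ∘ₖ M.stateStep π h

lemma MDP.lintegral_stateStep (M : MDP S A) (π : Policy S A) (h : ℕ) (x : S) {f : S → ENNReal}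
    (hf : Measurable f) :
    ∫⁻ y, f y ∂(M.stateStep π h x) = ∫⁻ a, ∫⁻ y, f y ∂(M.P h (x, a)) ∂(π.act h x) := by
  rw [MDP.stateStep, Kernel.lintegral_snd _ _ hf,
    Kernel.lintegral_compProd _ _ _ (by fun_prop)]

/-- `MDP.stateLaw` peels off the first transition, as `MDP.traj` does; the forward induction over
stages in `ContextualMDP.IsAverage.lintegral_state` needs the last one peeled off instead. -/
lemma MDP.stateLaw_succ (M : MDP S A) (π : Policy S A) (i h : ℕ) :
    M.stateLaw π (i + 1) h = M.stateStep π (h + i) ∘ₖ M.stateLaw π i h := by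
  induction i generalizing h with
  | zero => simp [MDP.stateLaw]
  | succ i ih =>
    rw [MDP.stateLaw, ih (h + 1), Kernel.comp_assoc, add_right_comm, add_assoc, MDP.stateLaw]

/-- Markov property: the record of one stage depends on the past only through the current state, and
the later stages integrate to one. The conditional laws below are all read off from this formula. -/
lemma MDP.lintegral_traj_eval (M : MDP S A) (π : Policy S A) (n h : ℕ) (i : Fin n) (x : S)
    {g : Transition S A → ENNReal} (hg : Measurable g) :
    ∫⁻ ω, g (ω i) ∂(M.traj π n h x) =
      ∫⁻ y, ∫⁻ a, ∫⁻ r, ∫⁻ x', g (y, a, r, x') ∂(M.P (h + i) (y, a)) ∂(M.R (h + i) (y, a))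
        ∂(π.act (h + i) y) ∂(M.stateLaw π i h x) := by
  induction n generalizing h x with
  | zero => exact i.elim0
  | succ n ih =>
    rw [MDP.lintegral_traj_succ _ _ _ _ _ (by fun_prop)]
    have hF (k : ℕ) : Measurable fun y => ∫⁻ a, ∫⁻ r, ∫⁻ x', g (y, a, r, x')
        ∂(M.P k (y, a)) ∂(M.R k (y, a)) ∂(π.act k y) := by
      have h1 : Measurable fun q : (S × A) × unitInterval => ∫⁻ x', g (q.1.1, q.1.2, q.2, x')
          ∂(M.P k).prodMkRight unitInterval q := Measurable.lintegral_kernel_prod_right'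
        (f := fun p : ((S × A) × unitInterval) × S => g (p.1.1.1, p.1.1.2, p.1.2, p.2)) (by fun_prop)
      have h2 : Measurable fun q : S × A => ∫⁻ r, ∫⁻ x', g (q.1, q.2, r, x')
          ∂(M.P k q) ∂(M.R k q) := Measurable.lintegral_kernel_prod_right' h1
      exact Measurable.lintegral_kernel_prod_right' h2
    refine Fin.cases ?_ (fun j => ?_) i
    · simp only [consStep, Fin.cons_zero, Fin.val_zero, add_zero, lintegral_const, measure_univ,
        mul_one, MDP.stateLaw]
      rw [Kernel.id_apply, lintegral_dirac' _ (hF h)]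
    · simp only [consStep, Fin.cons_succ, ih, lintegral_const, measure_univ, mul_one, Fin.val_succ,
        MDP.stateLaw]
      rw [Kernel.lintegral_comp _ _ _ (hF _), MDP.lintegral_stateStep _ _ _ _
        (Measurable.lintegral_kernel (hF _))]
      simp only [add_assoc, add_comm 1]

lemma MDP.lintegral_traj_state (M : MDP S A) (π : Policy S A) {n h : ℕ} (i : Fin n) (x : S)
    {g : S → ENNReal} (hg : Measurable g) :
    ∫⁻ ω, g (ω i).1 ∂(M.traj π n h x) = ∫⁻ y, g y ∂(M.stateLaw π i h x) := by
  rw [M.lintegral_traj_eval π n h i x (g := fun t => g t.1) (by fun_prop)]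
  simp

lemma MDP.lintegral_traj_action (M : MDP S A) (π : Policy S A) {n h : ℕ} (i : Fin n) (x : S)
    {g : S × A → ENNReal} (hg : Measurable g) :
    ∫⁻ ω, g ((ω i).1, (ω i).2.1) ∂(M.traj π n h x) =
      ∫⁻ ω, ∫⁻ a, g ((ω i).1, a) ∂(π.act (h + i) (ω i).1) ∂(M.traj π n h x) := by
  rw [M.lintegral_traj_eval π n h i x (g := fun t => g (t.1, t.2.1)) (by fun_prop),
    M.lintegral_traj_state π i x (g := fun y => ∫⁻ a, g (y, a) ∂(π.act (h + i) y))
      (Measurable.lintegral_kernel_prod_right' hg)]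
  simp

/-- Together with its analogue for rewards, this is the disintegration that
`IsAverageKernel.lintegral_bind_eq` requires within each context. -/
lemma MDP.lintegral_traj_next (M : MDP S A) (π : Policy S A) {n h : ℕ} (i : Fin n) (x : S)
    {g : (S × A) × S → ENNReal} (hg : Measurable g) :
    ∫⁻ ω, g (((ω i).1, (ω i).2.1), (ω i).2.2.2) ∂(M.traj π n h x) =
      ∫⁻ ω, ∫⁻ y, g (((ω i).1, (ω i).2.1), y) ∂(M.P (h + i) ((ω i).1, (ω i).2.1))
        ∂(M.traj π n h x) := by
  rw [M.lintegral_traj_eval π n h i x (g := fun t => g ((t.1, t.2.1), t.2.2.2)) (by fun_prop),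
    M.lintegral_traj_eval π n h i x
      (g := fun t => ∫⁻ y, g ((t.1, t.2.1), y) ∂(M.P (h + i) (t.1, t.2.1)))
      ((Measurable.lintegral_kernel_prod_right' hg).comp (f := fun t : Transition S A =>
        (t.1, t.2.1)) (by fun_prop))]
  simp

lemma MDP.lintegral_traj_reward (M : MDP S A) (π : Policy S A) {n h : ℕ} (i : Fin n) (x : S)
    {g : (S × A) × unitInterval → ENNReal} (hg : Measurable g) :
    ∫⁻ ω, g (((ω i).1, (ω i).2.1), (ω i).2.2.1) ∂(M.traj π n h x) =
      ∫⁻ ω, ∫⁻ y, g (((ω i).1, (ω i).2.1), y) ∂(M.R (h + i) ((ω i).1, (ω i).2.1))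
        ∂(M.traj π n h x) := by
  rw [M.lintegral_traj_eval π n h i x (g := fun t => g ((t.1, t.2.1), t.2.2.1)) (by fun_prop),
    M.lintegral_traj_eval π n h i x
      (g := fun t => ∫⁻ y, g ((t.1, t.2.1), y) ∂(M.R (h + i) (t.1, t.2.1)))
      ((Measurable.lintegral_kernel_prod_right' hg).comp (f := fun t : Transition S A =>
        (t.1, t.2.1)) (by fun_prop))]
  simp

end Trajectories

/-! ### The merged data follows the average MDP stage by stage -/

section MergedLaw

variable {C S A : Type*} [MeasurableSpace C] [MeasurableSpace S] [MeasurableSpace A]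

lemma ContextualMDP.measurable_traj_context (M : ContextualMDP C S A) (π : Policy S A) (n h : ℕ)
    (x : S) : Measurable fun c => (M.mdp c).traj π n h x :=
  (M.measurable_traj π n h).comp (measurable_id.prodMk measurable_const)

instance ContextualMDP.isProbabilityMeasure_mergedLaw (M : ContextualMDP C S A) (p : Measure C)
    [IsProbabilityMeasure p] (π : Policy S A) (x₁ : S) (H : ℕ) :
    IsProbabilityMeasure (M.mergedLaw p π x₁ H) :=
  isProbabilityMeasure_bind (M.measurable_traj_context π H 0 x₁).aemeasurable
    (ae_of_all _ fun _ => inferInstance)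

lemma ContextualMDP.lintegral_mergedLaw (M : ContextualMDP C S A) (p : Measure C)
    (π : Policy S A) (x₁ : S) (H : ℕ) {f : Trajectory S A H → ENNReal} (hf : Measurable f) :
    ∫⁻ ω, f ω ∂(M.mergedLaw p π x₁ H) = ∫⁻ c, ∫⁻ ω, f ω ∂((M.mdp c).traj π H 0 x₁) ∂p :=
  Measure.lintegral_bind (M.measurable_traj_context π H 0 x₁).aemeasurable hf.aemeasurable

/-- If `κbar` averages the conditional laws `κ c` of `y` given `z` over the contexts, then it is
the conditional law of `y` given `z` in the mixture over the contexts. -/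
lemma IsAverageKernel.lintegral_bind_eq {Ω Z Y : Type*} [MeasurableSpace Ω] [MeasurableSpace Z]
    [MeasurableSpace Y] {p : Measure C} [IsProbabilityMeasure p] {ρ : C → Measure Ω}
    [∀ c, IsProbabilityMeasure (ρ c)] (hρ : Measurable ρ) {z : Ω → Z} (hz : Measurable z)
    {y : Ω → Y} (hy : Measurable y) {κ : C → Kernel Z Y} {κbar : Kernel Z Y}
    [IsMarkovKernel κbar] [∀ c, IsMarkovKernel (κ c)]
    (havg : IsAverageKernel p (fun c => (ρ c).map z) κ κbar)
    (hcond : ∀ c (g : Z × Y → ENNReal), Measurable g →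
      ∫⁻ ω, g (z ω, y ω) ∂(ρ c) = ∫⁻ ω, ∫⁻ b, g (z ω, b) ∂(κ c (z ω)) ∂(ρ c))
    {g : Z × Y → ENNReal} (hg : Measurable g) :
    ∫⁻ ω, g (z ω, y ω) ∂(p.bind ρ) = ∫⁻ ω, ∫⁻ b, g (z ω, b) ∂(κbar (z ω)) ∂(p.bind ρ) := by
  have : IsProbabilityMeasure (p.bind ρ) :=
    isProbabilityMeasure_bind hρ.aemeasurable (ae_of_all _ fun _ => inferInstance)
  have : IsProbabilityMeasure ((p.bind ρ).map z) := Measure.isProbabilityMeasure_map hz.aemeasurable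
  have : IsProbabilityMeasure ((p.bind ρ).map fun ω => (z ω, y ω)) :=
    Measure.isProbabilityMeasure_map (hz.prodMk hy).aemeasurable
  -- Two finite measures on `Z × Y` agree if they do on rectangles `E ×ˢ B`, and there the claim is
  -- `IsAverageKernel`.
  have key : (p.bind ρ).map (fun ω => (z ω, y ω)) = ((p.bind ρ).map z) ⊗ₘ κbar := by
    refine Measure.ext_prod fun {E B} hE hB => ?_
    have hm : Measurable ((z ⁻¹' E).indicator fun ω => κbar (z ω) B) :=
      ((Kernel.measurable_coe _ hB).comp hz).indicator (hz hE)
    rw [Measure.compProd_apply_prod hE hB, Measure.restrict_map hz hE,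
      lintegral_map (Kernel.measurable_coe _ hB) hz, Measure.map_apply (hz.prodMk hy) (hE.prod hB),
      Measure.bind_apply (hz.prodMk hy (hE.prod hB)) hρ.aemeasurable,
      ← lintegral_indicator (hz hE), Measure.lintegral_bind hρ.aemeasurable
      hm.aemeasurable]
    have h := havg E B hE hB
    simp only [Measure.restrict_map hz hE, lintegral_map (Kernel.measurable_coe _ hB) hz] at h
    simp only [lintegral_indicator (hz hE)]
    rw [h]
    refine lintegral_congr fun c => ?_
    have h2 := hcond c ((E ×ˢ B).indicator 1) (measurable_one.indicator (hE.prod hB))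
    rw [← lintegral_indicator (hz hE)]
    calc ρ c ((fun ω => (z ω, y ω)) ⁻¹' E ×ˢ B)
        = ∫⁻ ω, (E ×ˢ B).indicator 1 (z ω, y ω) ∂(ρ c) := by
          rw [← lintegral_indicator_one (hz.prodMk hy (hE.prod hB))]
          rfl
      _ = _ := by
        rw [h2]
        refine lintegral_congr fun ω => ?_
        by_cases hω : z ω ∈ E
        · rw [Set.indicator_of_mem (show ω ∈ z ⁻¹' E from hω), ← lintegral_indicator_one hB]
          refine lintegral_congr fun b => ?_
          by_cases hb : b ∈ B <;> simp [hω, hb]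
        · rw [Set.indicator_of_notMem (show ω ∉ z ⁻¹' E from hω)]
          simp [hω]
  calc ∫⁻ ω, g (z ω, y ω) ∂(p.bind ρ) = ∫⁻ q, g q ∂((p.bind ρ).map fun ω => (z ω, y ω)) :=
        (lintegral_map hg (hz.prodMk hy)).symm
    _ = _ := by
      rw [key, Measure.lintegral_compProd hg,
        lintegral_map (Measurable.lintegral_kernel_prod_right' hg) hz]

variable {M : ContextualMDP C S A} {p : Measure C} {π : Policy S A} {x₁ : S} {H : ℕ}

/-- The policy does not see the context, so it stays the conditional law of the action after mixing,
without any averaging. -/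
lemma ContextualMDP.lintegral_mergedLaw_action (h : Fin H) {g : S × A → ENNReal}
    (hg : Measurable g) :
    ∫⁻ ω, g ((ω h).1, (ω h).2.1) ∂(M.mergedLaw p π x₁ H) =
      ∫⁻ ω, ∫⁻ a, g ((ω h).1, a) ∂(π.act h (ω h).1) ∂(M.mergedLaw p π x₁ H) := by
  have h1 : Measurable fun y => ∫⁻ a, g (y, a) ∂(π.act h y) :=
    Measurable.lintegral_kernel_prod_right' hg
  rw [M.lintegral_mergedLaw p π x₁ H (by fun_prop), M.lintegral_mergedLaw p π x₁ H
    (f := fun ω => ∫⁻ a, g ((ω h).1, a) ∂(π.act h (ω h).1))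
    (h1.comp (f := fun ω : Trajectory S A H => (ω h).1) (by fun_prop))]
  refine lintegral_congr fun c => ?_
  simpa using (M.mdp c).lintegral_traj_action π (n := H) (h := 0) h x₁ hg

variable [IsProbabilityMeasure p] {Mbar : MDP S A}

lemma ContextualMDP.IsAverage.lintegral_next (hM : M.IsAverage p π x₁ H Mbar) (h : Fin H)
    {g : (S × A) × S → ENNReal} (hg : Measurable g) :
    ∫⁻ ω, g (((ω h).1, (ω h).2.1), (ω h).2.2.2) ∂(M.mergedLaw p π x₁ H) =
      ∫⁻ ω, ∫⁻ y, g (((ω h).1, (ω h).2.1), y) ∂(Mbar.P h ((ω h).1, (ω h).2.1))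
        ∂(M.mergedLaw p π x₁ H) := by
  refine (hM h).1.lintegral_bind_eq (M.measurable_traj_context π H 0 x₁)
    (z := fun ω => ((ω h).1, (ω h).2.1)) (y := fun ω => (ω h).2.2.2) (by fun_prop) (by fun_prop)
    (fun c g hg => ?_) hg
  simpa using (M.mdp c).lintegral_traj_next π (n := H) (h := 0) h x₁ hg

lemma ContextualMDP.IsAverage.lintegral_reward (hM : M.IsAverage p π x₁ H Mbar) (h : Fin H)
    {g : (S × A) × unitInterval → ENNReal} (hg : Measurable g) :
    ∫⁻ ω, g (((ω h).1, (ω h).2.1), (ω h).2.2.1) ∂(M.mergedLaw p π x₁ H) =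
      ∫⁻ ω, ∫⁻ y, g (((ω h).1, (ω h).2.1), y) ∂(Mbar.R h ((ω h).1, (ω h).2.1))
        ∂(M.mergedLaw p π x₁ H) := by
  refine (hM h).2.lintegral_bind_eq (M.measurable_traj_context π H 0 x₁)
    (z := fun ω => ((ω h).1, (ω h).2.1)) (y := fun ω => (ω h).2.2.1) (by fun_prop) (by fun_prop)
    (fun c g hg => ?_) hg
  simpa using (M.mdp c).lintegral_traj_reward π (n := H) (h := 0) h x₁ hg

/-- Induction on the stage: given the state, the action is drawn from the policy and the next state
from `Mbar.P`, even in the mixture. Only the marginals agree with those of `Mbar`; the joint law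
over several stages need not. -/
lemma ContextualMDP.IsAverage.lintegral_state (hM : M.IsAverage p π x₁ H Mbar) (h : Fin H)
    {g : S → ENNReal} (hg : Measurable g) :
    ∫⁻ ω, g (ω h).1 ∂(M.mergedLaw p π x₁ H) = ∫⁻ y, g y ∂(Mbar.stateLaw π h 0 x₁) := by
  obtain ⟨i, hi⟩ := h
  induction i generalizing g with
  | zero =>
    rw [M.lintegral_mergedLaw p π x₁ H (by fun_prop)]
    simp only [MDP.lintegral_traj_state _ π _ _ hg, MDP.stateLaw, lintegral_const, measure_univ,
      mul_one]
  | succ i ih =>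
    have hi' : i < H := by omega
    let k : Fin H := ⟨i, hi'⟩
    have h2 : Measurable fun z : S × A => ∫⁻ y, g y ∂(Mbar.P i z) :=
      Measurable.lintegral_kernel hg
    have h3 : Measurable fun x => ∫⁻ a, ∫⁻ y, g y ∂(Mbar.P i (x, a)) ∂(π.act i x) :=
      Measurable.lintegral_kernel_prod_right' h2
    -- The state of stage `i + 1` has the law of the next state recorded at stage `i`; this is
    -- checked inside each context.
    have h1 : ∫⁻ ω, g (ω ⟨i + 1, hi⟩).1 ∂(M.mergedLaw p π x₁ H) =
        ∫⁻ ω, g (ω k).2.2.2 ∂(M.mergedLaw p π x₁ H) := by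
      rw [M.lintegral_mergedLaw p π x₁ H (by fun_prop), M.lintegral_mergedLaw p π x₁ H
        (by fun_prop)]
      refine lintegral_congr fun c => ?_
      have h4 : Measurable fun z : S × A => ∫⁻ y, g y ∂((M.mdp c).P i z) :=
        Measurable.lintegral_kernel hg
      have h5 : Measurable fun x => ∫⁻ a, ∫⁻ y, g y ∂((M.mdp c).P i (x, a)) ∂(π.act i x) :=
        Measurable.lintegral_kernel_prod_right' h4
      rw [MDP.lintegral_traj_state _ π _ _ hg,
        (M.mdp c).lintegral_traj_next π k x₁ (g := fun q => g q.2) (by fun_prop)]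
      simp only [zero_add, k]
      have h6 := (M.mdp c).lintegral_traj_action π (n := H) (h := 0) k x₁ h4
      simp only [zero_add, k] at h6
      rw [h6, (M.mdp c).lintegral_traj_state π k x₁ h5, MDP.stateLaw_succ,
        Kernel.lintegral_comp _ _ _ hg]
      simp only [MDP.lintegral_stateStep _ _ _ _ hg, zero_add, k]
    rw [h1, hM.lintegral_next k (g := fun q => g q.2) (by fun_prop)]
    rw [ContextualMDP.lintegral_mergedLaw_action k h2, ih h3 hi', MDP.stateLaw_succ,
        Kernel.lintegral_comp _ _ _ hg]
    simp only [MDP.lintegral_stateStep _ _ _ _ hg, zero_add]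

/-- The state-action law of the average MDP is that of the mixture over the contexts. -/
lemma ContextualMDP.IsAverage.map_eq_occupancy (hM : M.IsAverage p π x₁ H Mbar) (h : Fin H) :
    (M.mergedLaw p π x₁ H).map (fun ω => ((ω h).1, (ω h).2.1)) = Mbar.occupancy π x₁ h := by
  refine Measure.ext_of_lintegral _ fun g hg => ?_
  have h1 : Measurable fun y => ∫⁻ a, g (y, a) ∂(π.act h y) :=
    Measurable.lintegral_kernel_prod_right' hg
  rw [MDP.occupancy, lintegral_map hg (by fun_prop), lintegral_map hg (by fun_prop),
    ContextualMDP.lintegral_mergedLaw_action h hg, hM.lintegral_state h h1,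
    Mbar.lintegral_traj_action π h x₁ hg]
  simp only [zero_add]
  rw [Mbar.lintegral_traj_state π h x₁ h1]

end MergedLaw

/-! ### Values, Bellman backups and propagation of errors -/

section Value

lemma sum_reward_mem_Icc {S A : Type*} {n : ℕ} (ω : Trajectory S A n) :
    ∑ i : Fin n, ((ω i).2.2.1 : ℝ) ∈ Set.Icc (0 : ℝ) n := by
  refine ⟨Finset.sum_nonneg fun i _ => (ω i).2.2.1.2.1, ?_⟩
  calc ∑ i : Fin n, ((ω i).2.2.1 : ℝ) ≤ ∑ _i : Fin n, (1 : ℝ) :=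
        Finset.sum_le_sum fun i _ => (ω i).2.2.1.2.2
    _ = n := by simp

variable {S A : Type*} [MeasurableSpace S] [MeasurableSpace A]

lemma measurable_sum_reward {n : ℕ} :
    Measurable fun ω : Trajectory S A n => ∑ i : Fin n, ((ω i).2.2.1 : ℝ) :=
  Finset.measurable_sum _ fun i _ => measurable_subtype_coe.comp (by fun_prop)

lemma integrable_of_mem_Icc {X : Type*} [MeasurableSpace X] {μ : Measure X} [IsFiniteMeasure μ]
    {f : X → ℝ} (hf : Measurable f) {l u : ℝ} (h : ∀ x, f x ∈ Set.Icc l u) : Integrable f μ :=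
  Integrable.of_mem_Icc l u hf.aemeasurable (ae_of_all _ h)

lemma integral_mem_Icc {X : Type*} [MeasurableSpace X] {μ : Measure X} [IsProbabilityMeasure μ]
    {f : X → ℝ} {u : ℝ} (h : ∀ x, f x ∈ Set.Icc 0 u) : ∫ x, f x ∂μ ∈ Set.Icc 0 u := by
  refine ⟨integral_nonneg fun x => (h x).1, ?_⟩
  have := norm_integral_le_of_norm_le_const (μ := μ) (f := f) (C := u)
    (ae_of_all _ fun x => by rw [Real.norm_of_nonneg (h x).1]; exact (h x).2)
  simp only [probReal_univ, mul_one] at this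
  exact (le_abs_self _).trans this

lemma MDP.value_mem_Icc (M : MDP S A) (π : Policy S A) (n h : ℕ) (x : S) :
    M.value π n h x ∈ Set.Icc (0 : ℝ) n :=
  integral_mem_Icc sum_reward_mem_Icc

lemma MDP.measurable_value (M : MDP S A) (π : Policy S A) (n h : ℕ) :
    Measurable (M.value π n h) :=
  (measurable_sum_reward.stronglyMeasurable.integral_kernel (κ := M.traj π n h)).measurable

/-- The expected reward plus the expected value of the next state. -/
def MDP.bellman (M : MDP S A) (h : ℕ) (V : S → ℝ) (z : S × A) : ℝ :=
  ∫ r, (r : ℝ) ∂(M.R h z) + ∫ x, V x ∂(M.P h z)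

lemma MDP.measurable_meanReward (M : MDP S A) (h : ℕ) :
    Measurable fun z => ∫ r, (r : ℝ) ∂(M.R h z) :=
  (measurable_subtype_coe.stronglyMeasurable.integral_kernel (κ := M.R h)).measurable

lemma MDP.measurable_nextValue (M : MDP S A) (h : ℕ) {V : S → ℝ} (hV : Measurable V) :
    Measurable fun z => ∫ x, V x ∂(M.P h z) :=
  (hV.stronglyMeasurable.integral_kernel (κ := M.P h)).measurable

lemma MDP.measurable_bellman (M : MDP S A) (h : ℕ) {V : S → ℝ} (hV : Measurable V) :
    Measurable (M.bellman h V) :=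
  (M.measurable_meanReward h).add (M.measurable_nextValue h hV)

lemma MDP.bellman_mem_Icc (M : MDP S A) (h : ℕ) {V : S → ℝ} {u : ℝ}
    (hV : ∀ x, V x ∈ Set.Icc 0 u) (z : S × A) : M.bellman h V z ∈ Set.Icc 0 (1 + u) := by
  have h1 : ∫ r : unitInterval, (r : ℝ) ∂(M.R h z) ∈ Set.Icc (0 : ℝ) 1 :=
    integral_mem_Icc fun r => r.2
  have h2 : ∫ x, V x ∂(M.P h z) ∈ Set.Icc 0 u := integral_mem_Icc hV
  exact ⟨add_nonneg h1.1 h2.1, add_le_add h1.2 h2.2⟩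

lemma MDP.bellman_le_bellman_add (M : MDP S A) (h : ℕ) {V W : S → ℝ} (hV : Measurable V)
    (hW : Measurable W) {u u' e : ℝ} (hVu : ∀ x, V x ∈ Set.Icc 0 u)
    (hWu : ∀ x, W x ∈ Set.Icc 0 u') (hVW : ∀ x, V x ≤ W x + e) (z : S × A) :
    M.bellman h V z ≤ M.bellman h W z + e := by
  have h1 : ∫ x, V x ∂(M.P h z) ≤ ∫ x, (W x + e) ∂(M.P h z) :=
    integral_mono (integrable_of_mem_Icc hV hVu)
      ((integrable_of_mem_Icc hW hWu).add (integrable_const e)) hVW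
  rw [integral_add (integrable_of_mem_Icc hW hWu) (integrable_const e)] at h1
  simp only [integral_const, probReal_univ, one_smul] at h1
  simp only [MDP.bellman]
  linarith

lemma MDP.value_succ (M : MDP S A) (π : Policy S A) (n h : ℕ) (x : S) :
    M.value π (n + 1) h x = ∫ a, M.bellman h (M.value π n (h + 1)) (x, a) ∂(π.act h x) := by
  rw [MDP.value, M.integral_traj_succ π n h x measurable_sum_reward (c := n + 1) fun ω => by
    have := sum_reward_mem_Icc ω
    rw [abs_of_nonneg this.1]
    exact_mod_cast this.2]
  congr 1
  ext a
  simp only [consStep, Fin.sum_univ_succ, Fin.cons_zero, Fin.cons_succ]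
  have h1 (y : S) (r : unitInterval) :
      ∫ ω : Trajectory S A n, ((r : ℝ) + ∑ i, ((ω i).2.2.1 : ℝ)) ∂(M.traj π n (h + 1) y) =
        r + M.value π n (h + 1) y := by
    rw [integral_add (integrable_const _)
      (integrable_of_mem_Icc measurable_sum_reward sum_reward_mem_Icc)]
    simp [MDP.value]
  have h2 (r : unitInterval) : ∫ y, ((r : ℝ) + M.value π n (h + 1) y) ∂(M.P h (x, a)) =
      r + ∫ y, M.value π n (h + 1) y ∂(M.P h (x, a)) := by
    rw [integral_add (integrable_const _)
      (integrable_of_mem_Icc (M.measurable_value π n _) (M.value_mem_Icc π n _))]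
    simp
  simp only [h1, h2, MDP.bellman]
  rw [integral_add (integrable_of_mem_Icc measurable_subtype_coe fun r => r.2)
    (integrable_const _)]
  simp

/-- A family of functions that dominates its Bellman backup along `π` up to `e` per stage
dominates the value of `π` up to the accumulated error. -/
lemma MDP.value_le_of_backup_le (M : MDP S A) (π : Policy S A) {H : ℕ} {V : ℕ → S → ℝ} {u e : ℝ}
    (hV : ∀ h ≤ H, Measurable (V h)) (hVu : ∀ h ≤ H, ∀ x, V h x ∈ Set.Icc 0 u)
    (hstep : ∀ h < H, ∀ x, ∫ a, M.bellman h (V (h + 1)) (x, a) ∂(π.act h x) ≤ V h x + e)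
    {n h : ℕ} (hn : h + n = H) (x : S) : M.value π n h x ≤ V h x + n * e := by
  induction n generalizing h x with
  | zero =>
    have := (hVu h (by omega) x).1
    simpa [MDP.value] using this
  | succ n ih =>
    rw [MDP.value_succ]
    have hb := M.measurable_bellman h (M.measurable_value π n (h + 1))
    have hb' := M.measurable_bellman h (hV (h + 1) (by omega))
    have hi := M.bellman_mem_Icc h (M.value_mem_Icc π n (h + 1))
    have hi' := M.bellman_mem_Icc h (hVu (h + 1) (by omega))
    have hint : Integrable (fun a => M.bellman h (V (h + 1)) (x, a)) (π.act h x) :=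
      integrable_of_mem_Icc (by fun_prop) fun a => hi' (x, a)
    calc ∫ a, M.bellman h (M.value π n (h + 1)) (x, a) ∂(π.act h x)
        ≤ ∫ a, (M.bellman h (V (h + 1)) (x, a) + n * e) ∂(π.act h x) := by
          refine integral_mono (integrable_of_mem_Icc (by fun_prop) fun a => hi (x, a))
            (hint.add (integrable_const _)) fun a => ?_
          exact M.bellman_le_bellman_add h (M.measurable_value π n (h + 1)) (hV (h + 1) (by omega))
            (M.value_mem_Icc π n (h + 1)) (hVu (h + 1) (by omega))
            (fun y => ih (by omega) y) (x, a)
      _ = ∫ a, M.bellman h (V (h + 1)) (x, a) ∂(π.act h x) + n * e := by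
          rw [integral_add hint (integrable_const _)]
          simp
      _ ≤ V h x + (n + 1 : ℕ) * e := by
          have := hstep h (by omega) x
          push_cast
          linarith

/-- A family of functions that is dominated by its Bellman backup along `π` up to `e` per stage
is dominated by the value of `π` up to the accumulated error. -/
lemma MDP.le_value_of_le_backup (M : MDP S A) (π : Policy S A) {H : ℕ} {V : ℕ → S → ℝ} {u e : ℝ}
    (hV : ∀ h ≤ H, Measurable (V h)) (hVu : ∀ h ≤ H, ∀ x, V h x ∈ Set.Icc 0 u)
    (hH : ∀ x, V H x = 0)
    (hstep : ∀ h < H, ∀ x, V h x ≤ ∫ a, M.bellman h (V (h + 1)) (x, a) ∂(π.act h x) + e)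
    {n h : ℕ} (hn : h + n = H) (x : S) : V h x ≤ M.value π n h x + n * e := by
  induction n generalizing h x with
  | zero =>
    obtain rfl : h = H := by omega
    simp [MDP.value, hH]
  | succ n ih =>
    rw [MDP.value_succ]
    have hb := M.measurable_bellman h (M.measurable_value π n (h + 1))
    have hb' := M.measurable_bellman h (hV (h + 1) (by omega))
    have hi := M.bellman_mem_Icc h (M.value_mem_Icc π n (h + 1))
    have hi' := M.bellman_mem_Icc h (hVu (h + 1) (by omega))
    have hint : Integrable (fun a => M.bellman h (M.value π n (h + 1)) (x, a)) (π.act h x) :=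
      integrable_of_mem_Icc (by fun_prop) fun a => hi (x, a)
    calc V h x ≤ ∫ a, M.bellman h (V (h + 1)) (x, a) ∂(π.act h x) + e := hstep h (by omega) x
      _ ≤ ∫ a, (M.bellman h (M.value π n (h + 1)) (x, a) + n * e) ∂(π.act h x) + e := by
          refine add_le_add_left (integral_mono (integrable_of_mem_Icc (by fun_prop)
            fun a => hi' (x, a)) (hint.add (integrable_const _)) fun a => ?_) e
          exact M.bellman_le_bellman_add h (hV (h + 1) (by omega)) (M.measurable_value π n (h + 1))
            (hVu (h + 1) (by omega)) (M.value_mem_Icc π n (h + 1))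
            (fun y => ih (by omega) y) (x, a)
      _ = _ := by
          rw [integral_add hint (integrable_const _)]
          simp
          ring

end Value

/-! ### Suboptimality of a greedy policy in terms of its Bellman errors -/

namespace PEVI

variable {S A : Type*} {d K H : ℕ}

/-- `q` clipped to the interval `[0, l]`. -/
def clip (l q : ℝ) : ℝ := max (min q l) 0

lemma clip_mem_Icc {l : ℝ} (hl : 0 ≤ l) (q : ℝ) : clip l q ∈ Set.Icc 0 l :=
  ⟨le_max_right _ _, max_le (min_le_right _ _) hl⟩

lemma abs_clip_sub_clip_le (l q q' : ℝ) : |clip l q - clip l q'| ≤ |q - q'| :=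
  (abs_max_sub_max_le_abs _ _ _).trans (by
    have := abs_min_sub_min_le_max q l q' l
    simpa using this)

lemma clip_of_mem {l q : ℝ} (h : q ∈ Set.Icc 0 l) : clip l q = q := by
  rw [clip, min_eq_left h.2, max_eq_left h.1]

variable {φ : S × A → EuclideanSpace ℝ (Fin d)} {D : Dataset S A K H} {lam β : ℝ}

lemma Q_eq_clip (h : Fin H) (V : S → ℝ) (z : S × A) :
    Q φ D lam β h V z = clip ((H : ℝ) - (h : ℕ))
      ((φ z).ofLp ⬝ᵥ weight φ D lam h V - bonus φ D lam β h z) := rfl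

lemma stage_le (h : Fin H) : (0 : ℝ) ≤ (H : ℝ) - (h : ℕ) := by
  have := h.2
  rw [sub_nonneg]
  exact_mod_cast this.le

lemma Q_mem_Icc (h : Fin H) (V : S → ℝ) (z : S × A) :
    Q φ D lam β h V z ∈ Set.Icc 0 ((H : ℝ) - (h : ℕ)) :=
  clip_mem_Icc (stage_le h) _

variable [MeasurableSpace S] [MeasurableSpace A]

lemma measurable_Q (hφ : Measurable φ) (h : Fin H) (V : S → ℝ) :
    Measurable (Q φ D lam β h V) := by
  have hi (i : Fin d) : Measurable fun z => φ z i := by fun_prop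
  unfold Q bonus
  simp only [dotProduct, Matrix.mulVec]
  fun_prop

/-- If all Bellman errors of pessimistic value iteration are at most `e`, then the output is
optimal up to `2 H e`. -/
lemma value_sub_value_le (hφ : Measurable φ) (M : MDP S A) {π : Policy S A} {V : ℕ → S → ℝ}
    (hH : ∀ x, V H x = 0)
    (hV : ∀ h : Fin H, ∀ x, (∀ q : Measure A, IsProbabilityMeasure q →
      ∫ a, Q φ D lam β h (V (h + 1)) (x, a) ∂q
        ≤ ∫ a, Q φ D lam β h (V (h + 1)) (x, a) ∂(π.act h x)) ∧
      V h x = ∫ a, Q φ D lam β h (V (h + 1)) (x, a) ∂(π.act h x)) {e : ℝ}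
    (he : ∀ (h : Fin H) z, |M.bellman h (V (h + 1)) z - Q φ D lam β h (V (h + 1)) z| ≤ e)
    (π' : Policy S A) (x : S) : M.value π' H 0 x - M.value π H 0 x ≤ 2 * H * e := by
  have hmeas : ∀ h ≤ H, Measurable (V h) := by
    intro h hh
    rcases hh.eq_or_lt with rfl | hh
    · rw [show V h = fun _ => 0 from funext hH]
      exact measurable_const
    · rw [show V h = fun x => ∫ a, Q φ D lam β ⟨h, hh⟩ (V (h + 1)) (x, a) ∂(π.act h x) from
        funext fun x => (hV ⟨h, hh⟩ x).2]
      exact ((measurable_Q hφ ⟨h, hh⟩ (V (h + 1))).stronglyMeasurable.integral_kernel_prod_right'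
        (κ := π.act h)).measurable
  have hbdd : ∀ h ≤ H, ∀ x, V h x ∈ Set.Icc 0 (H : ℝ) := by
    intro h hh x
    rcases hh.eq_or_lt with rfl | hh
    · simp [hH]
    · rw [(hV ⟨h, hh⟩ x).2]
      refine integral_mem_Icc fun a => ?_
      have := Q_mem_Icc (φ := φ) (D := D) (lam := lam) (β := β) ⟨h, hh⟩ (V (h + 1)) (x, a)
      refine ⟨this.1, this.2.trans ?_⟩
      simp
  have hQint (h : Fin H) (q : Measure A) [IsProbabilityMeasure q] (x : S) :
      Integrable (fun a => Q φ D lam β h (V (h + 1)) (x, a)) q := by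
    have := measurable_Q (D := D) (lam := lam) (β := β) hφ h (V (h + 1))
    exact integrable_of_mem_Icc (by fun_prop) fun a => Q_mem_Icc h _ (x, a)
  have hBint (h : Fin H) (q : Measure A) [IsProbabilityMeasure q] (x : S) :
      Integrable (fun a => M.bellman h (V (h + 1)) (x, a)) q := by
    have := M.measurable_bellman h (hmeas (h + 1) h.2)
    exact integrable_of_mem_Icc (by fun_prop) fun a => M.bellman_mem_Icc h (hbdd _ h.2) (x, a)
  have hup : M.value π' H 0 x ≤ V 0 x + H * e := by
    refine M.value_le_of_backup_le π' hmeas hbdd (fun h hh y => ?_) (by omega) x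
    rw [(hV ⟨h, hh⟩ y).2]
    -- Greediness enters here: the actions of `π'` do not give a larger average of `Q` than those of
    -- `π`. The lower bound `hlow` below only needs that `V h` is the average of `Q` under `π`.
    refine le_trans ?_ (add_le_add_left ((hV ⟨h, hh⟩ y).1 (π'.act h y) inferInstance) e)
    calc ∫ a, M.bellman h (V (h + 1)) (y, a) ∂(π'.act h y)
        ≤ ∫ a, (Q φ D lam β ⟨h, hh⟩ (V (h + 1)) (y, a) + e) ∂(π'.act h y) :=
          integral_mono (hBint ⟨h, hh⟩ _ y) ((hQint ⟨h, hh⟩ _ y).add (integrable_const _))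
            fun a => by
              have := (abs_le.1 (he ⟨h, hh⟩ (y, a))).2
              dsimp only at this ⊢
              linarith
      _ = _ := by
        rw [integral_add (hQint ⟨h, hh⟩ _ y) (integrable_const _)]
        simp
  have hlow : V 0 x ≤ M.value π H 0 x + H * e := by
    refine M.le_value_of_le_backup π hmeas hbdd hH (fun h hh y => ?_) (by omega) x
    rw [(hV ⟨h, hh⟩ y).2]
    calc ∫ a, Q φ D lam β ⟨h, hh⟩ (V (h + 1)) (y, a) ∂(π.act h y)
        ≤ ∫ a, (M.bellman h (V (h + 1)) (y, a) + e) ∂(π.act h y) :=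
          integral_mono (hQint ⟨h, hh⟩ _ y) ((hBint ⟨h, hh⟩ _ y).add (integrable_const _))
            fun a => by
              have := (abs_le.1 (he ⟨h, hh⟩ (y, a))).1
              dsimp only at this ⊢
              linarith
      _ = _ := by
        rw [integral_add (hBint ⟨h, hh⟩ _ y) (integrable_const _)]
        simp
  linarith

end PEVI

/-! ### Regularized least squares -/

section Gram

open Matrix

variable {d K : ℕ}

lemma dotProduct_sq_le {ι : Type*} [Fintype ι] (x y : ι → ℝ) :
    (x ⬝ᵥ y) ^ 2 ≤ (x ⬝ᵥ x) * (y ⬝ᵥ y) := by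
  simpa only [dotProduct, sq] using Finset.sum_mul_sq_le_sq_mul_sq Finset.univ x y

lemma dotProduct_self_nonneg' {ι : Type*} [Fintype ι] (x : ι → ℝ) : 0 ≤ x ⬝ᵥ x :=
  Finset.sum_nonneg fun i _ => mul_self_nonneg (x i)

lemma abs_dotProduct_le {ι : Type*} [Fintype ι] (x y : ι → ℝ) {a b : ℝ} (ha : 0 ≤ a) (hb : 0 ≤ b)
    (hx : x ⬝ᵥ x ≤ a ^ 2) (hy : y ⬝ᵥ y ≤ b ^ 2) : |x ⬝ᵥ y| ≤ a * b := by
  refine abs_le_of_sq_le_sq ?_ (by positivity)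
  rw [mul_pow]
  exact (dotProduct_sq_le x y).trans (mul_le_mul hx hy (dotProduct_self_nonneg' y) (by positivity))

/-- The Gram matrix of the vectors `f τ`, regularized by the identity. -/
def regGram (f : Fin K → Fin d → ℝ) : Matrix (Fin d) (Fin d) ℝ :=
  ∑ τ, vecMulVec (f τ) (f τ) + (1 : ℝ) • 1

lemma regGram_mulVec (f : Fin K → Fin d → ℝ) (y : Fin d → ℝ) :
    regGram f *ᵥ y = ∑ τ, (f τ ⬝ᵥ y) • f τ + y := by
  rw [regGram, add_mulVec, sum_mulVec, smul_mulVec, one_mulVec, one_smul]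
  simp [vecMulVec_mulVec]

lemma dotProduct_regGram_mulVec (f : Fin K → Fin d → ℝ) (x y : Fin d → ℝ) :
    x ⬝ᵥ regGram f *ᵥ y = ∑ τ, (f τ ⬝ᵥ x) * (f τ ⬝ᵥ y) + x ⬝ᵥ y := by
  rw [regGram_mulVec, dotProduct_add, dotProduct_sum]
  congr 1
  refine Finset.sum_congr rfl fun τ _ => ?_
  rw [dotProduct_smul, smul_eq_mul, dotProduct_comm x, mul_comm]

lemma dotProduct_le_regGram (f : Fin K → Fin d → ℝ) (y : Fin d → ℝ) :
    y ⬝ᵥ y ≤ y ⬝ᵥ regGram f *ᵥ y := by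
  rw [dotProduct_regGram_mulVec]
  exact le_add_of_nonneg_left (Finset.sum_nonneg fun τ _ => mul_self_nonneg _)

lemma isUnit_regGram (f : Fin K → Fin d → ℝ) : IsUnit (regGram f) := by
  rw [← mulVec_injective_iff_isUnit, ← coe_mulVecLin, injective_iff_map_eq_zero]
  intro y hy
  rw [mulVecLin_apply] at hy
  have := dotProduct_le_regGram f y
  rw [hy, dotProduct_zero] at this
  exact dotProduct_self_eq_zero.1 (le_antisymm this (dotProduct_self_nonneg' y))

lemma regGram_mulVec_inv (f : Fin K → Fin d → ℝ) (x : Fin d → ℝ) :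
    regGram f *ᵥ ((regGram f)⁻¹ *ᵥ x) = x := by
  rw [mulVec_mulVec, mul_nonsing_inv _ ((isUnit_iff_isUnit_det _).1 (isUnit_regGram f)),
    one_mulVec]

/-- The matrix dominates the identity, so `y = Λ⁻¹ x` satisfies `y ⬝ᵥ y ≤ y ⬝ᵥ Λ y = y ⬝ᵥ x`, and
Cauchy–Schwarz shows that the inverse is a contraction. This keeps the parameters of PEVI in a box.
-/
lemma inv_regGram_mulVec_sq_le (f : Fin K → Fin d → ℝ) (x : Fin d → ℝ) {a : ℝ}
    (hx : x ⬝ᵥ x ≤ a ^ 2) :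
    ((regGram f)⁻¹ *ᵥ x) ⬝ᵥ ((regGram f)⁻¹ *ᵥ x) ≤ a ^ 2 := by
  set y := (regGram f)⁻¹ *ᵥ x with hy
  have h1 := dotProduct_le_regGram f y
  rw [regGram_mulVec_inv] at h1
  have h2 := dotProduct_sq_le y x
  have h3 := dotProduct_self_nonneg' y
  rcases h3.eq_or_lt with h | h
  · rw [← h]; positivity
  · refine le_trans ?_ hx
    by_contra hc
    push Not at hc
    nlinarith

lemma abs_apply_le_of_dotProduct_self {ι : Type*} [Fintype ι] (x : ι → ℝ) {a : ℝ} (ha : 0 ≤ a)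
    (hx : x ⬝ᵥ x ≤ a ^ 2) (i : ι) : |x i| ≤ a := by
  refine abs_le_of_sq_le_sq (le_trans ?_ hx) ha
  rw [sq]
  exact Finset.single_le_sum (f := fun i => x i * x i) (fun i _ => mul_self_nonneg (x i))
    (Finset.mem_univ i)

lemma abs_inv_regGram_apply_le (f : Fin K → Fin d → ℝ) (i j : Fin d) :
    |(regGram f)⁻¹ i j| ≤ 1 := by
  have h := inv_regGram_mulVec_sq_le f (Pi.single j 1) (a := 1) (by simp)
  have := abs_apply_le_of_dotProduct_self _ zero_le_one h i
  simpa using this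

/-- Error of regularized least squares at `x`, with `y = Λ⁻¹ x`. -/
lemma dotProduct_inv_regGram_sub (f : Fin K → Fin d → ℝ) (t : Fin K → ℝ) (x w : Fin d → ℝ) :
    x ⬝ᵥ ((regGram f)⁻¹ *ᵥ ∑ τ, t τ • f τ) - x ⬝ᵥ w =
      ∑ τ, (t τ - f τ ⬝ᵥ w) * (f τ ⬝ᵥ ((regGram f)⁻¹ *ᵥ x)) - ((regGram f)⁻¹ *ᵥ x) ⬝ᵥ w := by
  set y := (regGram f)⁻¹ *ᵥ x with hy
  set v := (regGram f)⁻¹ *ᵥ ∑ τ, t τ • f τ with hv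
  have hx : ∀ z, x ⬝ᵥ z = y ⬝ᵥ regGram f *ᵥ z := fun z => by
    rw [dotProduct_regGram_mulVec]
    conv_lhs => rw [← regGram_mulVec_inv f x, ← hy, dotProduct_comm, dotProduct_regGram_mulVec]
    simp only [mul_comm, dotProduct_comm z]
  rw [hx v, hx w, hv, regGram_mulVec_inv, dotProduct_regGram_mulVec, dotProduct_sum,
    ← sub_sub, ← Finset.sum_sub_distrib]
  congr 1
  refine Finset.sum_congr rfl fun τ _ => ?_
  rw [dotProduct_smul, smul_eq_mul, dotProduct_comm y]
  ring

/-- The elliptic norm `√(xᵀ Λ⁻¹ x)` is small if the Gram matrix is large. -/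
lemma sqrt_dotProduct_inv_regGram_le (f : Fin K → Fin d → ℝ) (x : Fin d → ℝ) (hx : x ⬝ᵥ x ≤ 1)
    {κ : ℝ} (hκ : 0 < κ) (hcov : ∀ u, κ * (u ⬝ᵥ u) ≤ ∑ τ, (f τ ⬝ᵥ u) ^ 2) :
    √(x ⬝ᵥ (regGram f)⁻¹ *ᵥ x) ≤ 1 / √κ := by
  rw [← Real.sqrt_one, ← Real.sqrt_div zero_le_one]
  apply Real.sqrt_le_sqrt
  set y := (regGram f)⁻¹ *ᵥ x with hy
  -- With `y = Λ⁻¹ x` one gets `κ (x ⬝ᵥ y)² ≤ κ (y ⬝ᵥ y) ≤ x ⬝ᵥ y`, hence `x ⬝ᵥ y ≤ 1 / κ`.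
  have h1 : x ⬝ᵥ y = ∑ τ, (f τ ⬝ᵥ y) ^ 2 + y ⬝ᵥ y := by
    rw [dotProduct_comm, ← regGram_mulVec_inv f x, ← hy, dotProduct_regGram_mulVec]
    simp only [sq]
  have h2 := hcov y
  have h3 := dotProduct_sq_le x y
  have h4 := dotProduct_self_nonneg' y
  have h5 : κ * (y ⬝ᵥ y) ≤ x ⬝ᵥ y := by linarith
  have h6 : (x ⬝ᵥ y) ^ 2 ≤ y ⬝ᵥ y := by nlinarith
  rw [le_div_iff₀ hκ]
  rcases (show 0 ≤ x ⬝ᵥ y by nlinarith).eq_or_lt with h | h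
  · rw [← h]; simp
  · by_contra hc
    push Not at hc
    nlinarith

/-- Self-normalized bound on the error of regularized least squares. -/
lemma abs_dotProduct_inv_regGram_sub_le (f : Fin K → Fin d → ℝ) (t : Fin K → ℝ)
    (x w : Fin d → ℝ) {L B W : ℝ} (hL : 0 < L) (hB : 0 ≤ B) (hW : 0 ≤ W) (hw : w ⬝ᵥ w ≤ W ^ 2)
    (hnoise : ∀ u : Fin d → ℝ, u ⬝ᵥ u ≤ L →
      ∑ τ, (t τ - f τ ⬝ᵥ w) * (f τ ⬝ᵥ u) ≤ B * ((∑ τ, (f τ ⬝ᵥ u) ^ 2) / 2 + 7 * L)) :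
    |x ⬝ᵥ ((regGram f)⁻¹ *ᵥ ∑ τ, t τ • f τ) - x ⬝ᵥ w| ≤
      √(x ⬝ᵥ (regGram f)⁻¹ *ᵥ x) * (8 * B * √L + W) := by
  rw [dotProduct_inv_regGram_sub]
  set y := (regGram f)⁻¹ *ᵥ x with hy
  have h1 : x ⬝ᵥ y = ∑ τ, (f τ ⬝ᵥ y) ^ 2 + y ⬝ᵥ y := by
    rw [dotProduct_comm, ← regGram_mulVec_inv f x, ← hy, dotProduct_regGram_mulVec]
    simp only [sq]
  have hG : 0 ≤ ∑ τ, (f τ ⬝ᵥ y) ^ 2 := Finset.sum_nonneg fun τ _ => sq_nonneg _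
  have hy0 := dotProduct_self_nonneg' y
  have hxy : 0 ≤ x ⬝ᵥ y := by linarith
  set b := √(x ⬝ᵥ y) with hb
  have hb2 : b ^ 2 = x ⬝ᵥ y := Real.sq_sqrt hxy
  have hb0 : 0 ≤ b := Real.sqrt_nonneg _
  have hyw : |y ⬝ᵥ w| ≤ b * W := abs_dotProduct_le y w hb0 hW (by linarith) hw
  have hsum : |∑ τ, (t τ - f τ ⬝ᵥ w) * (f τ ⬝ᵥ y)| ≤ b * (8 * B * √L) := by
    rcases hb0.eq_or_lt with h0 | h0
    · have : y = 0 := dotProduct_self_eq_zero.1 (by rw [← h0] at hb2; nlinarith)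
      simp [this, ← h0]
    · have hsL := Real.sq_sqrt hL.le
      have hsL0 : 0 < √L := Real.sqrt_pos.2 hL
      -- The noise bound is not homogeneous in `u`. At `u = ± (√L / b) • y` its quadratic sum is at
      -- most `L`, so both of its terms are of order `L` and add up to less than `8 L`. The norm
      -- condition holds since `y ⬝ᵥ y ≤ b ^ 2`.
      have key : ∀ s : ℝ, s ^ 2 = (√L / b) ^ 2 →
          s * ∑ τ, (t τ - f τ ⬝ᵥ w) * (f τ ⬝ᵥ y) ≤ B * (8 * L) := by
        intro s hs
        have hs' : s ^ 2 * b ^ 2 = L := by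
          rw [hs, div_pow, hsL]
          field_simp
        have h2 := hnoise (s • y) (by
          rw [dotProduct_smul, smul_dotProduct, smul_eq_mul, smul_eq_mul, ← mul_assoc, ← sq, ← hs']
          gcongr
          linarith)
        simp only [dotProduct_smul, smul_eq_mul, mul_pow, ← Finset.mul_sum, mul_left_comm _ s] at h2
        refine h2.trans (mul_le_mul_of_nonneg_left ?_ hB)
        have : s ^ 2 * ∑ τ, (f τ ⬝ᵥ y) ^ 2 ≤ s ^ 2 * b ^ 2 := by
          gcongr
          linarith
        linarith
      have k1 := key (√L / b) rfl
      have k2 := key (-(√L / b)) (by ring)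
      set N := ∑ τ, (t τ - f τ ⬝ᵥ w) * (f τ ⬝ᵥ y)
      have k3 : √L / b * |N| ≤ B * (8 * L) := by
        rcases abs_cases N with ⟨h, -⟩ | ⟨h, -⟩ <;> rw [h] <;> linarith
      have k4 : √L * |N| ≤ √L * (b * (8 * B * √L)) := by
        calc √L * |N| = (√L / b * |N|) * b := by field_simp
          _ ≤ (B * (8 * L)) * b := by gcongr
          _ = _ := by nth_rw 1 [← hsL]; ring
      exact le_of_mul_le_mul_left k4 hsL0
  calc _ ≤ |∑ τ, (t τ - f τ ⬝ᵥ w) * (f τ ⬝ᵥ y)| + |y ⬝ᵥ w| := abs_sub _ _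
    _ ≤ b * (8 * B * √L) + b * W := add_le_add hsum hyw
    _ = _ := by ring

end Gram

/-! ### Empirical covariance under good exploration -/

section Features

open Matrix

lemma ofLp_dotProduct_self_le_one {d : ℕ} {x : EuclideanSpace ℝ (Fin d)} (hx : ‖x‖ ≤ 1) :
    x.ofLp ⬝ᵥ x.ofLp ≤ 1 := by
  have h := EuclideanSpace.real_norm_sq_eq x
  simp only [dotProduct, ← sq]
  rw [← h]
  exact pow_le_one₀ (norm_nonneg _) hx

lemma ofLp_dotProduct_self_eq {d : ℕ} (x : EuclideanSpace ℝ (Fin d)) :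
    x.ofLp ⬝ᵥ x.ofLp = ‖x‖ ^ 2 := by
  rw [EuclideanSpace.real_norm_sq_eq x]
  simp only [dotProduct, ← sq]

lemma dotProduct_self_le_of_abs_le {ι : Type*} [Fintype ι] (x : ι → ℝ) {η : ℝ}
    (hx : ∀ i, |x i| ≤ η) : x ⬝ᵥ x ≤ Fintype.card ι * η ^ 2 := by
  calc x ⬝ᵥ x ≤ ∑ _i : ι, η ^ 2 := Finset.sum_le_sum fun i _ => by
        rw [← sq]; exact sq_le_sq' (neg_le_of_abs_le (hx i)) (le_of_abs_le (hx i))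
    _ = _ := by simp

/-- A vector with entries at most `η` in absolute value has norm at most `n η` in dimension `n`. -/
lemma dotProduct_self_le_sq_of_abs_le {d : ℕ} (x : Fin d → ℝ) {η : ℝ}
    (hx : ∀ i, |x i| ≤ η) : x ⬝ᵥ x ≤ (d * η) ^ 2 := by
  refine (dotProduct_self_le_of_abs_le x hx).trans ?_
  rw [Fintype.card_fin, mul_pow]
  gcongr
  exact_mod_cast Nat.le_self_pow two_ne_zero d

variable {C S A : Type*} [MeasurableSpace C] [MeasurableSpace S] [MeasurableSpace A]
  {M : ContextualMDP C S A} {p : Measure C} [IsProbabilityMeasure p] {πb : Policy S A}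
  {x₁ : S} {d H : ℕ} {Mbar : MDP S A} {φ : S × A → EuclideanSpace ℝ (Fin d)}

lemma measurable_dotProduct_feature (hφ : Measurable φ) (u : Fin d → ℝ) :
    Measurable fun z => (φ z).ofLp ⬝ᵥ u := by
  have hi (i : Fin d) : Measurable fun z => φ z i := by fun_prop
  simp only [dotProduct]
  fun_prop

instance MDP.isProbabilityMeasure_occupancy (N : MDP S A) (π : Policy S A) (x : S) (h : Fin H) :
    IsProbabilityMeasure (N.occupancy π x h) :=
  Measure.isProbabilityMeasure_map (by fun_prop)

lemma MDP.integral_dotProduct_sq (N : MDP S A) (π : Policy S A) (x : S)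
    (hφ : Measurable φ) (hφ1 : ∀ z, ‖φ z‖ ≤ 1) (h : Fin H) (u : Fin d → ℝ) :
    ∫ z, ((φ z).ofLp ⬝ᵥ u) ^ 2 ∂(N.occupancy π x h) = u ⬝ᵥ N.covariance π x φ h *ᵥ u := by
  have hi (i : Fin d) : Measurable fun z => φ z i := by fun_prop
  have hle (z) (i : Fin d) : |φ z i| ≤ 1 :=
    abs_apply_le_of_dotProduct_self _ zero_le_one (by
      simpa using ofLp_dotProduct_self_le_one (hφ1 z)) i
  have hint (i j : Fin d) : Integrable (fun z => φ z i * φ z j) (N.occupancy π x h) :=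
    Integrable.of_bound (Measurable.aestronglyMeasurable (by fun_prop)) 1 (ae_of_all _ fun z => by
      rw [Real.norm_eq_abs, abs_mul]
      exact mul_le_one₀ (hle z i) (abs_nonneg _) (hle z j))
  have h1 (z) : ((φ z).ofLp ⬝ᵥ u) ^ 2 = ∑ i, ∑ j, u i * (u j * (φ z i * φ z j)) := by
    rw [sq, dotProduct, Finset.sum_mul_sum]
    refine Finset.sum_congr rfl fun i _ => Finset.sum_congr rfl fun j _ => by ring
  simp only [h1]
  rw [integral_finsetSum _ fun i _ => integrable_finsetSum _ fun j _ =>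
    ((hint i j).const_mul _).const_mul _]
  simp only [dotProduct, mulVec, MDP.covariance, Matrix.of_apply]
  refine Finset.sum_congr rfl fun i _ => ?_
  rw [integral_finsetSum _ fun j _ => ((hint i j).const_mul _).const_mul _, Finset.mul_sum]
  refine Finset.sum_congr rfl fun j _ => ?_
  rw [integral_const_mul, integral_const_mul]
  ring

lemma MDP.WellExplored.le_dotProduct_covariance {N : MDP S A} {π : Policy S A} {x : S} {c : ℝ}
    (hN : N.WellExplored π H x φ c) (h : Fin H) (u : Fin d → ℝ) :
    c / d * (u ⬝ᵥ u) ≤ u ⬝ᵥ N.covariance π x φ h *ᵥ u := by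
  have := (hN.2 h).dotProduct_mulVec_nonneg u
  rw [sub_mulVec, smul_mulVec, one_mulVec, dotProduct_sub, dotProduct_smul, star_trivial,
    smul_eq_mul] at this
  linarith

/-- With high probability, the empirical covariance of a well-explored stage is bounded below. -/
lemma exists_event_covariance (hM : M.IsAverage p πb x₁ H Mbar) {c : ℝ} (hc : 0 < c)
    (hE : Mbar.WellExplored πb H x₁ φ c) (hd : 0 < d) (hH : 0 < H) (K : ℕ) {δ : ℝ} (hδ : 0 < δ)
    (hK : 8 * Real.log (H * (16 * d ^ 2 / c + 2) ^ d / δ) * (d ^ 2 / c ^ 2) ≤ K) :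
    ∃ E : Set (Dataset S A K H), MeasurableSet E ∧
      M.datasetLaw p πb x₁ K H Eᶜ ≤ ENNReal.ofReal δ ∧
      ∀ D ∈ E, ∀ (h : Fin H) (u : Fin d → ℝ),
        K * c / (2 * d) * (u ⬝ᵥ u) ≤ ∑ τ, (PEVI.feat φ D h τ ⬝ᵥ u) ^ 2 := by
  have hd' : (0 : ℝ) < d := by exact_mod_cast hd
  have hφ := hE.1.1
  have hφ1 := hE.1.2.1
  -- Moving a unit vector by `η` per coordinate changes `(φ ⬝ᵥ u) ^ 2` by at most `2 d η = c / (4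
  -- d)`. Of the mean `c / d`, one quarter is lost to the net, one quarter to the deviation, and
  -- half survives.
  let η : ℝ := c / (8 * d ^ 2)
  have hη : 0 < η := by positivity
  let T := {u : Fin d → ℝ // u ⬝ᵥ u = 1}
  obtain ⟨F, hF, hnet⟩ := exists_finset_net (fun (u : T) i => u.1 i) zero_le_one
    (fun u i => abs_apply_le_of_dotProduct_self _ zero_le_one (by simp [u.2]) i) hη
  -- The exponent in the Chernoff bound for the lower tail. With `8 L ≤ K s ^ 2` the deficit of the
  -- sum is at most `L / s + K s / 8 ≤ K s / 4`.
  let s : ℝ := c / d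
  have hs : 0 < s := by positivity
  let X : Fin H × T → Trajectory S A H → ℝ := fun i ω =>
    ((φ ((ω i.1).1, (ω i.1).2.1)).ofLp ⬝ᵥ i.2.1) ^ 2
  have hX (i) : Measurable (X i) :=
    ((measurable_dotProduct_feature hφ i.2.1).comp
      (f := fun ω : Trajectory S A H => ((ω i.1).1, (ω i.1).2.1)) (by fun_prop)).pow_const 2
  have hX1 (i ω) : X i ω ∈ Set.Icc (0 : ℝ) 1 := by
    refine ⟨sq_nonneg _, (dotProduct_sq_le _ _).trans ?_⟩
    rw [i.2.2, mul_one]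
    exact ofLp_dotProduct_self_le_one (hφ1 _)
  have hm (i : Fin H × T) : c / d ≤ ∫ ω, X i ω ∂(M.mergedLaw p πb x₁ H) := by
    have h1 := hE.le_dotProduct_covariance i.1 i.2.1
    rw [i.2.2, mul_one, ← MDP.integral_dotProduct_sq _ _ _ hφ hφ1, ← hM.map_eq_occupancy,
      integral_map (by fun_prop)
        ((measurable_dotProduct_feature hφ i.2.1).pow_const 2).aestronglyMeasurable] at h1
    exact h1
  obtain ⟨E, hEm, hEp, hEs⟩ := exists_event_sum_le (M.mergedLaw p πb x₁ H) K
    ((Finset.univ : Finset (Fin H)) ×ˢ F)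
    (fun i ω => -s * (X i ω - ∫ ω', X i ω' ∂(M.mergedLaw p πb x₁ H)) - (-s) ^ 2 * 1 ^ 2 / 8)
    (fun i _ => by have := hX i; fun_prop)
    (fun i _ => lintegral_exp_sub_integral_le _ (hX i) (hX1 i) (-s))
    (N := H * (16 * d ^ 2 / c + 2) ^ d) (δ := δ) (by
      rw [Finset.card_product, Finset.card_univ, Fintype.card_fin]
      push_cast
      gcongr
      refine hF.trans_eq ?_
      rw [Fintype.card_fin]
      congr 2
      simp only [η]
      field_simp
      norm_num) (by positivity) hδ
  refine ⟨E, hEm, hEp, fun D hD h u => ?_⟩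
  have hunit : ∀ v : T, K * c / (2 * d) ≤ ∑ τ, (PEVI.feat φ D h τ ⬝ᵥ v.1) ^ 2 := by
    intro v
    obtain ⟨v', hv', hvv⟩ := hnet v
    have h1 := hEs D hD (h, v') (by simp [hv'])
    have h2 : K * c / d * (3 / 4) ≤ ∑ τ, X (h, v') (D τ) := by
      rw [Finset.sum_sub_distrib, ← Finset.mul_sum, Finset.sum_sub_distrib] at h1
      simp only [Finset.sum_const, Finset.card_univ, Fintype.card_fin, nsmul_eq_mul] at h1
      have h3 := hm (h, v')
      set m := ∫ ω', X (h, v') ω' ∂(M.mergedLaw p πb x₁ H)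
      set Y := ∑ τ, X (h, v') (D τ)
      set L := Real.log (H * (16 * d ^ 2 / c + 2) ^ d / δ)
      have h4 : 8 * L ≤ K * s ^ 2 := by
        have : 8 * L * (d ^ 2 / c ^ 2) * (s ^ 2) ≤ K * s ^ 2 := by gcongr
        refine le_trans (le_of_eq ?_) this
        simp only [s]
        field_simp
      have h5 : s * (K * m - Y) ≤ s * (K * s / 4) := by nlinarith
      have h6 := le_of_mul_le_mul_left h5 hs
      have h7 : K * s ≤ K * m := by gcongr
      have h8 : K * c / d = K * s := by simp only [s]; ring
      rw [h8]
      linarith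
    have h9 : ∀ τ, X (h, v') (D τ) - c / (4 * d) ≤ (PEVI.feat φ D h τ ⬝ᵥ v.1) ^ 2 := by
      intro τ
      have hb : PEVI.feat φ D h τ ⬝ᵥ PEVI.feat φ D h τ ≤ 1 := ofLp_dotProduct_self_le_one (hφ1 _)
      have e1 : |PEVI.feat φ D h τ ⬝ᵥ v.1| ≤ 1 * 1 :=
        abs_dotProduct_le _ _ zero_le_one zero_le_one (by simpa using hb) (by simp [v.2])
      have e2 : |PEVI.feat φ D h τ ⬝ᵥ v'.1| ≤ 1 * 1 :=
        abs_dotProduct_le _ _ zero_le_one zero_le_one (by simpa using hb) (by simp [v'.2])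
      have e3 : |PEVI.feat φ D h τ ⬝ᵥ (v.1 - v'.1)| ≤ 1 * (d * η) :=
        abs_dotProduct_le _ _ zero_le_one (by positivity) (by simpa using hb)
          (dotProduct_self_le_sq_of_abs_le _ hvv)
      rw [dotProduct_sub] at e3
      have e4 : c / (4 * d) = 2 * (d * η) := by simp only [η]; field_simp; norm_num
      change (PEVI.feat φ D h τ ⬝ᵥ v'.1) ^ 2 - _ ≤ _
      rw [e4]
      rw [abs_le] at e1 e2 e3
      nlinarith
    have h10 := Finset.sum_le_sum fun τ (_ : τ ∈ Finset.univ) => h9 τ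
    rw [Finset.sum_sub_distrib] at h10
    simp only [Finset.sum_const, Finset.card_univ, Fintype.card_fin, nsmul_eq_mul] at h10
    have h11 : K * c / (2 * d) = K * c / d * (3 / 4) - K * (c / (4 * d)) := by
      field_simp
      ring
    linarith
  rcases (dotProduct_self_nonneg' u).eq_or_lt with h0 | h0
  · rw [← h0, mul_zero]
    exact Finset.sum_nonneg fun τ _ => sq_nonneg _
  · have hr := Real.sqrt_pos.2 h0
    have hr2 := Real.sq_sqrt h0.le
    set r := √(u ⬝ᵥ u)
    have h1 := hunit ⟨r⁻¹ • u, by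
      rw [smul_dotProduct, dotProduct_smul, smul_eq_mul, smul_eq_mul, ← hr2]
      field_simp⟩
    simp only [dotProduct_smul, smul_eq_mul, mul_pow, ← Finset.mul_sum] at h1
    rw [inv_pow, hr2, inv_mul_eq_div, le_div_iff₀ h0] at h1
    exact h1

end Features

/-! ### Temporal differences, and the class of pessimistic value functions -/

section Noise

open Matrix

variable {C S A : Type*} [MeasurableSpace C] [MeasurableSpace S] [MeasurableSpace A]
  {M : ContextualMDP C S A} {p : Measure C} [IsProbabilityMeasure p] {πb : Policy S A}
  {x₁ : S} {d H : ℕ} {Mbar : MDP S A} {φ : S × A → EuclideanSpace ℝ (Fin d)}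

/-- The temporal difference of `V` at the `h`-th transition of a trajectory. -/
def tdError (Mbar : MDP S A) (h : Fin H) (V : S → ℝ) (ω : Trajectory S A H) : ℝ :=
  (ω h).2.2.1 + V (ω h).2.2.2 - Mbar.bellman h V ((ω h).1, (ω h).2.1)

lemma measurable_tdError (Mbar : MDP S A) (h : Fin H) {V : S → ℝ} (hV : Measurable V) :
    Measurable (tdError Mbar h V) := by
  have h1 := Mbar.measurable_bellman h hV
  have h2 : Measurable fun ω : Trajectory S A H => ((ω h).2.2.1 : ℝ) :=
    measurable_subtype_coe.comp (by fun_prop)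
  unfold tdError
  fun_prop

lemma abs_tdError_le (h : Fin H) {V : S → ℝ}
    (hV : ∀ x, V x ∈ Set.Icc 0 ((H : ℝ) - ((h : ℕ) + 1))) (ω : Trajectory S A H) :
    |tdError Mbar h V ω| ≤ H := by
  have h1 := Mbar.bellman_mem_Icc h hV ((ω h).1, (ω h).2.1)
  have h2 := hV (ω h).2.2.2
  have h3 := (ω h).2.2.1.2
  have h4 : (0 : ℝ) ≤ (h : ℕ) := Nat.cast_nonneg _
  rw [Set.mem_Icc] at h1 h2 h3
  rw [tdError, abs_le]
  constructor <;> linarith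

lemma abs_tdError_sub_le (h : Fin H) {V W : S → ℝ} (hV : Measurable V) (hW : Measurable W)
    {u e : ℝ} (hVu : ∀ x, V x ∈ Set.Icc 0 u) (hWu : ∀ x, W x ∈ Set.Icc 0 u)
    (he : ∀ x, |V x - W x| ≤ e) (ω : Trajectory S A H) :
    |tdError Mbar h V ω - tdError Mbar h W ω| ≤ 2 * e := by
  have h1 := Mbar.bellman_le_bellman_add h hV hW hVu hWu (e := e)
    (fun x => by have := (abs_le.1 (he x)).2; linarith) ((ω h).1, (ω h).2.1)
  have h2 := Mbar.bellman_le_bellman_add h hW hV hWu hVu (e := e)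
    (fun x => by have := (abs_le.1 (he x)).1; linarith) ((ω h).1, (ω h).2.1)
  have h3 := abs_le.1 (he (ω h).2.2.2)
  simp only [tdError]
  rw [abs_le]
  constructor <;> linarith

/-- Given the state and the action, temporal differences are subgaussian in the merged data. -/
lemma ContextualMDP.IsAverage.lintegral_exp_tdError_le (hM : M.IsAverage p πb x₁ H Mbar)
    (hφ : Measurable φ) (h : Fin H) {V : S → ℝ} (hV : Measurable V)
    (hVH : ∀ x, V x ∈ Set.Icc 0 (H : ℝ)) (u : Fin d → ℝ) :
    ∫⁻ ω, ENNReal.ofReal (Real.exp (((φ ((ω h).1, (ω h).2.1)).ofLp ⬝ᵥ u) * tdError Mbar h V ω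
      / (2 * H) - ((φ ((ω h).1, (ω h).2.1)).ofLp ⬝ᵥ u) ^ 2 / 8)) ∂(M.mergedLaw p πb x₁ H) ≤ 1 := by
  have hH : (1 : ℝ) ≤ H := by exact_mod_cast (Nat.succ_le_of_lt (Nat.zero_lt_of_lt h.2))
  let g (z : S × A) : ℝ := (φ z).ofLp ⬝ᵥ u
  have hg : Measurable g := measurable_dotProduct_feature hφ u
  let rbar (z : S × A) : ℝ := ∫ r : unitInterval, (r : ℝ) ∂(Mbar.R h z)
  let Vbar (z : S × A) : ℝ := ∫ x, V x ∂(Mbar.P h z)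
  have hr : Measurable rbar := Mbar.measurable_meanReward h
  have hVb : Measurable Vbar := Mbar.measurable_nextValue h hV
  have hcoe : Measurable ((↑) : unitInterval → ℝ) := measurable_subtype_coe
  -- Only the separate conditional laws of reward and next state are known; the hidden context may
  -- correlate them. Convexity of `exp` splits the exponent into two halves, each governed by
  -- Hoeffding's lemma; hence the denominator `2 * H`.
  let f₁ (q : (S × A) × unitInterval) : ENNReal :=
    ENNReal.ofReal (Real.exp (g q.1 / H * (q.2 - rbar q.1) - (g q.1) ^ 2 / 8))
  let f₂ (q : (S × A) × S) : ENNReal :=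
    ENNReal.ofReal (Real.exp (g q.1 / H * (V q.2 - Vbar q.1) - (g q.1) ^ 2 / 8))
  have hf₁ : Measurable f₁ := by fun_prop
  have hf₂ : Measurable f₂ := by fun_prop
  have h1 : ∫⁻ ω, f₁ (((ω h).1, (ω h).2.1), (ω h).2.2.1) ∂(M.mergedLaw p πb x₁ H) ≤ 1 := by
    rw [hM.lintegral_reward h hf₁]
    refine (lintegral_mono fun ω => ?_).trans (b := ∫⁻ _, 1 ∂(M.mergedLaw p πb x₁ H)) (by simp)
    set z := ((ω h).1, (ω h).2.1)
    refine le_trans (lintegral_mono fun r => ?_) (lintegral_exp_sub_integral_le (Mbar.R h z)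
      hcoe (l := 1) (fun r => r.2) (g z / H))
    refine ENNReal.ofReal_le_ofReal (Real.exp_le_exp.2 (sub_le_sub_left ?_ _))
    rw [div_pow, one_pow, mul_one]
    gcongr
    exact div_le_self (sq_nonneg _) (one_le_pow₀ hH)
  have h2 : ∫⁻ ω, f₂ (((ω h).1, (ω h).2.1), (ω h).2.2.2) ∂(M.mergedLaw p πb x₁ H) ≤ 1 := by
    rw [hM.lintegral_next h hf₂]
    refine (lintegral_mono fun ω => ?_).trans (b := ∫⁻ _, 1 ∂(M.mergedLaw p πb x₁ H)) (by simp)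
    set z := ((ω h).1, (ω h).2.1)
    refine le_trans (lintegral_mono fun y => ?_) (lintegral_exp_sub_integral_le (Mbar.P h z)
      hV (l := H) hVH (g z / H))
    refine ENNReal.ofReal_le_ofReal (Real.exp_le_exp.2 (sub_le_sub_left (le_of_eq ?_) _))
    field_simp
  calc _ ≤ ∫⁻ ω, ENNReal.ofReal (1 / 2) * (f₁ (((ω h).1, (ω h).2.1), (ω h).2.2.1) +
        f₂ (((ω h).1, (ω h).2.1), (ω h).2.2.2)) ∂(M.mergedLaw p πb x₁ H) := by
        refine lintegral_mono fun ω => ?_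
        simp only [f₁, f₂]
        rw [← ENNReal.ofReal_add (Real.exp_pos _).le (Real.exp_pos _).le,
          ← ENNReal.ofReal_mul (by norm_num)]
        refine ENNReal.ofReal_le_ofReal ?_
        set z := ((ω h).1, (ω h).2.1) with hz
        have hconv := convexOn_exp.2 (Set.mem_univ (g z / H * ((ω h).2.2.1 - rbar z) - (g z) ^ 2 / 8))
          (Set.mem_univ (g z / H * (V (ω h).2.2.2 - Vbar z) - (g z) ^ 2 / 8))
          (by norm_num : (0 : ℝ) ≤ 1 / 2) (by norm_num : (0 : ℝ) ≤ 1 / 2) (by norm_num)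
        simp only [smul_eq_mul] at hconv
        rw [mul_add]
        refine le_trans (le_of_eq ?_) hconv
        congr 1
        simp only [tdError, MDP.bellman, ← hz, g, rbar, Vbar]
        field_simp
        ring
    _ ≤ ENNReal.ofReal (1 / 2) * (1 + 1) := by
        rw [lintegral_const_mul _ (by fun_prop), lintegral_add_left (by fun_prop)]
        gcongr
    _ = 1 := by
        rw [one_add_one_eq_two, ← ENNReal.ofReal_ofNat, ← ENNReal.ofReal_mul (by norm_num)]
        norm_num

/-- Value functions of the form that pessimistic value iteration produces, with clipping level `l`
and parameters at most `B`. -/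
structure PessimisticValue (φ : S × A → EuclideanSpace ℝ (Fin d)) (l B : ℝ) where
  /-- weight vector -/
  w : Fin d → ℝ
  /-- matrix of the bonus -/
  Y : Matrix (Fin d) (Fin d) ℝ
  /-- the value function -/
  V : S → ℝ
  abs_w_le : ∀ i, |w i| ≤ B
  abs_Y_le : ∀ i j, |Y i j| ≤ B
  -- A supremum over uncountably many actions need not be measurable, so measurability is recorded.
  -- The supremum form allows two values to be compared whatever greedy policies attain them.
  measurable : Measurable V
  isLUB : ∀ x, IsLUB (Set.range fun a => PEVI.clip l ((φ (x, a)).ofLp ⬝ᵥ w -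
    √((φ (x, a)).ofLp ⬝ᵥ Y *ᵥ (φ (x, a)).ofLp))) (V x)

omit [MeasurableSpace A] in
lemma PessimisticValue.mem_Icc [Nonempty A] {l B : ℝ} (hl : 0 ≤ l)
    (v : PessimisticValue φ l B) (x : S) : v.V x ∈ Set.Icc 0 l := by
  obtain ⟨a⟩ := ‹Nonempty A›
  refine ⟨le_trans (PEVI.clip_mem_Icc hl _).1 ((v.isLUB x).1 ⟨a, rfl⟩), (v.isLUB x).2 ?_⟩
  rintro _ ⟨a, rfl⟩
  exact (PEVI.clip_mem_Icc hl _).2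

/-- The square root in the bonus is only Hölder of order `1 / 2`, so a net of bonus matrices needs
the square of the desired precision as its mesh. -/
lemma abs_sqrt_sub_sqrt_le (a b : ℝ) : |√a - √b| ≤ √|a - b| := by
  wlog h : b ≤ a generalizing a b
  · rw [abs_sub_comm, abs_sub_comm a]
    exact this b a (le_of_not_ge h)
  rw [abs_of_nonneg (sub_nonneg.2 (Real.sqrt_le_sqrt h)), abs_of_nonneg (sub_nonneg.2 h),
    sub_le_iff_le_add]
  rcases le_or_gt 0 b with hb | hb
  · calc √a = √((a - b) + b) := by rw [sub_add_cancel]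
      _ ≤ _ := Real.sqrt_le_iff.2 ⟨by positivity, by
        have h1 := Real.sq_sqrt (sub_nonneg.2 h)
        have h2 := Real.sq_sqrt hb
        have h3 := mul_nonneg (Real.sqrt_nonneg (a - b)) (Real.sqrt_nonneg b)
        nlinarith⟩
  · rw [Real.sqrt_eq_zero_of_nonpos hb.le, add_zero]
    exact Real.sqrt_le_sqrt (by linarith)

lemma abs_dotProduct_mulVec_le {x : Fin d → ℝ} (hx : x ⬝ᵥ x ≤ 1) (Y : Matrix (Fin d) (Fin d) ℝ)
    {η : ℝ} (hη : 0 ≤ η) (hY : ∀ i j, |Y i j| ≤ η) : |x ⬝ᵥ Y *ᵥ x| ≤ d ^ 2 * η := by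
  have h1 (i : Fin d) : |x i| ≤ 1 := abs_apply_le_of_dotProduct_self x zero_le_one (by simpa using hx) i
  have h2 (i : Fin d) : |(Y *ᵥ x) i| ≤ d * η := by
    calc |(Y *ᵥ x) i| ≤ ∑ j, |Y i j * x j| :=
        Finset.abs_sum_le_sum_abs (fun j => Y i j * x j) Finset.univ
      _ ≤ ∑ _j : Fin d, η * 1 := Finset.sum_le_sum fun j _ => by
        rw [abs_mul]; exact mul_le_mul (hY i j) (h1 j) (abs_nonneg _) hη
      _ = d * η := by simp
  calc |x ⬝ᵥ Y *ᵥ x| ≤ ∑ i, |x i * (Y *ᵥ x) i| :=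
      Finset.abs_sum_le_sum_abs (fun i => x i * (Y *ᵥ x) i) Finset.univ
    _ ≤ ∑ _i : Fin d, 1 * (d * η) := Finset.sum_le_sum fun i _ => by
      rw [abs_mul]; exact mul_le_mul (h1 i) (h2 i) (abs_nonneg _) zero_le_one
    _ = d ^ 2 * η := by simp; ring

-- Clipping is 1-Lipschitz and suprema are compared action by action. The term `d * √η` is due to
-- the bonus and dominates for small `η`.
omit [MeasurableSpace A] in
lemma PessimisticValue.sub_le (hφ1 : ∀ z, ‖φ z‖ ≤ 1) {l B η : ℝ} (hη : 0 ≤ η)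
    (v v' : PessimisticValue φ l B) (hw : ∀ i, |v.w i - v'.w i| ≤ η)
    (hY : ∀ i j, |v.Y i j - v'.Y i j| ≤ η) (x : S) :
    v.V x ≤ v'.V x + (d * η + d * √η) := by
  refine (v.isLUB x).2 ?_
  rintro _ ⟨a, rfl⟩
  have h1 := (v'.isLUB x).1 ⟨a, rfl⟩
  dsimp only at h1 ⊢
  have hx := ofLp_dotProduct_self_le_one (hφ1 (x, a))
  set f := (φ (x, a)).ofLp
  have h2 : |f ⬝ᵥ v.w - f ⬝ᵥ v'.w| ≤ d * η := by
    rw [← dotProduct_sub]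
    simpa using abs_dotProduct_le f (v.w - v'.w) zero_le_one (by positivity) (by simpa using hx)
      (dotProduct_self_le_sq_of_abs_le _ hw)
  have h3 : |√(f ⬝ᵥ v.Y *ᵥ f) - √(f ⬝ᵥ v'.Y *ᵥ f)| ≤ d * √η := by
    refine (abs_sqrt_sub_sqrt_le _ _).trans ?_
    rw [← dotProduct_sub, ← sub_mulVec]
    calc √|f ⬝ᵥ (v.Y - v'.Y) *ᵥ f| ≤ √(d ^ 2 * η) :=
          Real.sqrt_le_sqrt (abs_dotProduct_mulVec_le hx _ hη hY)
      _ = _ := by rw [Real.sqrt_mul (by positivity), Real.sqrt_sq (by positivity)]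
  have h4 := PEVI.abs_clip_sub_clip_le l (f ⬝ᵥ v.w - √(f ⬝ᵥ v.Y *ᵥ f))
    (f ⬝ᵥ v'.w - √(f ⬝ᵥ v'.Y *ᵥ f))
  rw [abs_le] at h2 h3
  have h5 : |f ⬝ᵥ v.w - √(f ⬝ᵥ v.Y *ᵥ f) - (f ⬝ᵥ v'.w - √(f ⬝ᵥ v'.Y *ᵥ f))| ≤
      d * η + d * √η := abs_le.2 ⟨by linarith, by linarith⟩
  have h6 := (abs_le.1 (h4.trans h5)).2
  linarith

end Noise

/-! ### Noise bounds uniform over directions and value functions -/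

section UniformNoise

open Matrix

variable {C S A : Type*} [MeasurableSpace C] [MeasurableSpace S] [MeasurableSpace A]
  {M : ContextualMDP C S A} {p : Measure C} [IsProbabilityMeasure p] {πb : Policy S A}
  {x₁ : S} {d H : ℕ} {Mbar : MDP S A} {φ : S × A → EuclideanSpace ℝ (Fin d)}

lemma level_nonneg (h : Fin H) : (0 : ℝ) ≤ (H : ℝ) - ((h : ℕ) + 1) := by
  rw [sub_nonneg]
  exact_mod_cast h.2

lemma level_le (h : Fin H) : (H : ℝ) - ((h : ℕ) + 1) ≤ H := by
  have : (0 : ℝ) ≤ (h : ℕ) := Nat.cast_nonneg _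
  linarith

/-- With high probability, the noise of all directions and all pessimistic value functions in a
finite net is bounded in a self-normalized way. -/
lemma exists_event_noise_net [Nonempty A] (hM : M.IsAverage p πb x₁ H Mbar) (hφ : Measurable φ)
    (hH : 0 < H) (K : ℕ) {B η δ : ℝ} (hB : 0 < B) (hη : 0 < η) (hδ : 0 < δ) :
    ∃ E : Set (Dataset S A K H), MeasurableSet E ∧
      M.datasetLaw p πb x₁ K H Eᶜ ≤ ENNReal.ofReal δ ∧
      ∀ D ∈ E, ∀ (h : Fin H) (v : PessimisticValue φ ((H : ℝ) - ((h : ℕ) + 1)) B)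
        (u : Fin d → ℝ), (∀ i, |u i| ≤ B) →
        ∃ (v' : PessimisticValue φ ((H : ℝ) - ((h : ℕ) + 1)) B) (u' : Fin d → ℝ),
          (∀ i, |u i - u' i| ≤ η) ∧ (∀ i, |v.w i - v'.w i| ≤ η) ∧
          (∀ i j, |v.Y i j - v'.Y i j| ≤ η) ∧
          ∑ τ, ((PEVI.feat φ D h τ ⬝ᵥ u') * tdError Mbar h v'.V (D τ) / (2 * H)
            - (PEVI.feat φ D h τ ⬝ᵥ u') ^ 2 / 8)
            ≤ Real.log (H * (2 * B / η + 2) ^ (2 * d + d ^ 2) / δ) := by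
  let T (h : Fin H) := {u : Fin d → ℝ // ∀ i, |u i| ≤ B} ×
    PessimisticValue φ ((H : ℝ) - ((h : ℕ) + 1)) B
  -- Direction, weight vector and bonus matrix are covered jointly, in `2 d + d ^ 2` coordinates.
  -- The `d ^ 2` entries of the matrix determine the order of `L`.
  let θ (h : Fin H) (t : T h) : Fin d ⊕ Fin d ⊕ (Fin d × Fin d) → ℝ :=
    Sum.elim t.1.1 (Sum.elim t.2.w fun ij => t.2.Y ij.1 ij.2)
  have hθ (h : Fin H) (t : T h) (i) : |θ h t i| ≤ B := by
    rcases i with i | i | ⟨i, j⟩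
    · exact t.1.2 i
    · exact t.2.abs_w_le i
    · exact t.2.abs_Y_le i j
  choose F hF hnet using fun h : Fin H => exists_finset_net (θ h) hB.le (hθ h) hη
  have hcard : Fintype.card (Fin d ⊕ Fin d ⊕ (Fin d × Fin d)) = 2 * d + d ^ 2 := by
    simp only [Fintype.card_sum, Fintype.card_prod, Fintype.card_fin]
    ring
  have hVH (h : Fin H) (v : PessimisticValue φ ((H : ℝ) - ((h : ℕ) + 1)) B) (x : S) :
      v.V x ∈ Set.Icc 0 (H : ℝ) :=
    ⟨(v.mem_Icc (level_nonneg h) x).1, (v.mem_Icc (level_nonneg h) x).2.trans (level_le h)⟩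
  obtain ⟨E, hEm, hEp, hEs⟩ := exists_event_sum_le (M.mergedLaw p πb x₁ H) K
    (Finset.univ.sigma F)
    (fun i ω => ((φ ((ω i.1).1, (ω i.1).2.1)).ofLp ⬝ᵥ i.2.1.1) * tdError Mbar i.1 i.2.2.V ω
      / (2 * H) - ((φ ((ω i.1).1, (ω i.1).2.1)).ofLp ⬝ᵥ i.2.1.1) ^ 2 / 8)
    (fun i _ => by
      have h1 : Measurable fun ω : Trajectory S A H =>
          (φ ((ω i.1).1, (ω i.1).2.1)).ofLp ⬝ᵥ i.2.1.1 :=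
        (measurable_dotProduct_feature hφ i.2.1.1).comp (by fun_prop)
      have h2 := measurable_tdError Mbar i.1 i.2.2.measurable
      fun_prop)
    (fun i _ => hM.lintegral_exp_tdError_le hφ i.1 i.2.2.measurable (hVH i.1 i.2.2) i.2.1.1)
    (N := H * (2 * B / η + 2) ^ (2 * d + d ^ 2)) (δ := δ) (by
      rw [Finset.card_sigma]
      push_cast
      calc _ ≤ ∑ _h : Fin H, (2 * B / η + 2) ^ (2 * d + d ^ 2) :=
            Finset.sum_le_sum fun h _ => by rw [← hcard]; exact hF h
        _ = _ := by simp) (by positivity) hδ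
  refine ⟨E, hEm, hEp, fun D hD h v u hu => ?_⟩
  obtain ⟨⟨u', v'⟩, ht, hclose⟩ := hnet h (⟨u, hu⟩, v)
  exact ⟨v', u'.1, fun i => hclose (Sum.inl i), fun i => hclose (Sum.inr (Sum.inl i)),
    fun i j => hclose (Sum.inr (Sum.inr (i, j))), hEs D hD ⟨h, u', v'⟩ (by simp [ht])⟩

/-- Replacing the direction and the value function by nearby ones changes the noise little. -/
lemma noise_perturbation {a a' t t' H K s : ℝ} (hH : 1 ≤ H) (hK : 1 ≤ K) (hs0 : 0 ≤ s)
    (hs : 4 * K ^ 2 * s = 1) (ha : |a| ≤ K) (haa : |a - a'| ≤ s) (ht : |t'| ≤ H)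
    (htt : |t - t'| ≤ 4 * s) :
    t * a ≤ 2 * H * (a' * t' / (2 * H) - a' ^ 2 / 8) + H / 2 * a ^ 2 + H * (5 / K) := by
  have h1 : |t * a - a' * t'| ≤ 4 * s * K + H * s := by
    calc |t * a - a' * t'| = |(t - t') * a + t' * (a - a')| := by congr 1; ring
      _ ≤ |(t - t') * a| + |t' * (a - a')| := abs_add_le _ _
      _ ≤ 4 * s * K + H * s := by
        rw [abs_mul, abs_mul]
        exact add_le_add (mul_le_mul htt ha (abs_nonneg _) (by positivity))
          (mul_le_mul ht haa (abs_nonneg _) (by positivity))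
  have hsK : s * K ≤ 1 / K := by
    rw [le_div_iff₀ (by positivity)]
    linarith [mul_assoc s K K, sq K, mul_nonneg hs0 (sq_nonneg K)]
  have hsK' : s ≤ s * K := le_mul_of_one_le_right hs0 hK
  have hs1 : s ≤ 1 := by
    have : 1 / K ≤ 1 := by rw [div_le_one (by positivity)]; exact hK
    linarith
  have h2 : a' ^ 2 ≤ 2 * a ^ 2 + 2 * s := by
    have h3 : (a - a') ^ 2 ≤ s ^ 2 := sq_le_sq' (abs_le.1 haa).1 (abs_le.1 haa).2
    have h4 : s ^ 2 ≤ s := by rw [sq]; exact mul_le_of_le_one_left hs0 hs1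
    have h5 := sq_nonneg (a + (a - a'))
    have h6 : a' ^ 2 + (a + (a - a')) ^ 2 = 2 * a ^ 2 + 2 * (a - a') ^ 2 := by ring
    linarith
  have h7 : 2 * H * (a' * t' / (2 * H) - a' ^ 2 / 8) = a' * t' - H / 4 * a' ^ 2 := by
    field_simp
    ring
  -- Passing from `a'` to `a` doubles the compensator `H / 4 * a' ^ 2`, up to a term in `s`; this is
  -- the origin of `H / 2 * a ^ 2`.
  have h8 : H / 4 * a' ^ 2 ≤ H / 4 * (2 * a ^ 2 + 2 * s) := by gcongr
  have h9 : H * s ≤ H * (1 / K) := by gcongr; linarith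
  have h10 : 1 / K ≤ H * (1 / K) := le_mul_of_one_le_left (by positivity) hH
  have h11 : H * (5 / K) = 5 * (H * (1 / K)) := by ring
  have h12 := (abs_le.1 h1).2
  have h13 : 4 * s * K ≤ H * (1 / K) := by
    refine le_trans (le_of_eq ?_) h10
    rw [eq_div_iff (by positivity), ← hs]
    ring
  rw [h7, h11]
  have h14 : 0 ≤ H * (1 / K) := by positivity
  linarith [h8, h9, h12, h13, mul_add (H / 4) (2 * a ^ 2) (2 * s)]

/-- With high probability, the noise of all directions and all pessimistic value functions is
bounded in a self-normalized way. -/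
lemma exists_event_noise [Nonempty A] (hM : M.IsAverage p πb x₁ H Mbar) (hφ : Measurable φ)
    (hφ1 : ∀ z, ‖φ z‖ ≤ 1) (hd : 0 < d) (hH : 0 < H) {K : ℕ} (hK : 0 < K) {B L δ : ℝ}
    (hB : (K : ℝ) ≤ B) (hδ : 0 < δ) (hL1 : 1 ≤ L)
    (hL : Real.log (H * (32 * B * K ^ 4 * d ^ 2 + 2) ^ (2 * d + d ^ 2) / δ) ≤ L) :
    ∃ E : Set (Dataset S A K H), MeasurableSet E ∧
      M.datasetLaw p πb x₁ K H Eᶜ ≤ ENNReal.ofReal δ ∧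
      ∀ D ∈ E, ∀ (h : Fin H) (v : PessimisticValue φ ((H : ℝ) - ((h : ℕ) + 1)) B)
        (u : Fin d → ℝ), u ⬝ᵥ u ≤ (K : ℝ) ^ 2 →
        ∑ τ, tdError Mbar h v.V (D τ) * (PEVI.feat φ D h τ ⬝ᵥ u) ≤
          H * ((∑ τ, (PEVI.feat φ D h τ ⬝ᵥ u) ^ 2) / 2 + 7 * L) := by
  have hK1 : (1 : ℝ) ≤ K := by exact_mod_cast hK
  have hd1 : (1 : ℝ) ≤ d := by exact_mod_cast hd
  have hH1 : (1 : ℝ) ≤ H := by exact_mod_cast hH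
  -- The mesh is `ρ ^ 2`, so values move by at most `2 d ρ`, with `d ρ = 1 / (4 K ^ 2)`. Multiplied
  -- by `|φ ⬝ᵥ u| ≤ K` and summed over `K` samples, this leaves a total perturbation of order `H`.
  let ρ : ℝ := 1 / (4 * K ^ 2 * d)
  have hρ : 0 < ρ := by positivity
  obtain ⟨E, hEm, hEp, hEs⟩ := exists_event_noise_net (φ := φ) hM hφ hH K (B := B) (η := ρ ^ 2)
    (δ := δ) (by linarith) (by positivity) hδ
  refine ⟨E, hEm, hEp, fun D hD h v u hu => ?_⟩
  obtain ⟨v', u', huu, hww, hYY, hsum⟩ := hEs D hD h v u fun i =>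
    (abs_apply_le_of_dotProduct_self u (by positivity) hu i).trans hB
  have hdρ : 4 * K ^ 2 * (d * ρ) = 1 := by simp only [ρ]; field_simp
  have hdρ0 : 0 ≤ d * ρ := by positivity
  have hKdρ : K * (d * ρ) ≤ 1 / 4 := by nlinarith
  have hρ1 : ρ ≤ 1 := by nlinarith
  have hdρ2 : d * ρ ^ 2 ≤ d * ρ := by
    gcongr
    nlinarith
  have hsum' : ∑ τ, ((PEVI.feat φ D h τ ⬝ᵥ u') * tdError Mbar h v'.V (D τ) / (2 * H)
      - (PEVI.feat φ D h τ ⬝ᵥ u') ^ 2 / 8) ≤ L := by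
    refine hsum.trans (le_trans (le_of_eq ?_) hL)
    congr 4
    simp only [ρ]
    field_simp
    ring
  have hVV (x : S) : |v.V x - v'.V x| ≤ 2 * (d * ρ) := by
    have h1 := v.sub_le hφ1 (sq_nonneg ρ) v' hww hYY x
    have h2 := v'.sub_le hφ1 (sq_nonneg ρ) v (fun i => by rw [abs_sub_comm]; exact hww i)
      (fun i j => by rw [abs_sub_comm]; exact hYY i j) x
    rw [Real.sqrt_sq hρ.le] at h1 h2
    rw [abs_le]
    constructor <;> linarith
  have hterm (τ : Fin K) : tdError Mbar h v.V (D τ) * (PEVI.feat φ D h τ ⬝ᵥ u) ≤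
      2 * H * ((PEVI.feat φ D h τ ⬝ᵥ u') * tdError Mbar h v'.V (D τ) / (2 * H)
        - (PEVI.feat φ D h τ ⬝ᵥ u') ^ 2 / 8) + H / 2 * (PEVI.feat φ D h τ ⬝ᵥ u) ^ 2
        + H * (5 / K) := by
    have hf : PEVI.feat φ D h τ ⬝ᵥ PEVI.feat φ D h τ ≤ 1 ^ 2 := by
      rw [one_pow]
      exact ofLp_dotProduct_self_le_one (hφ1 _)
    set f := PEVI.feat φ D h τ
    have e1 : |f ⬝ᵥ u| ≤ 1 * K := abs_dotProduct_le _ _ zero_le_one (by positivity) hf hu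
    have e2 : |f ⬝ᵥ (u - u')| ≤ 1 * (d * ρ ^ 2) := abs_dotProduct_le _ _ zero_le_one (by positivity)
      hf (dotProduct_self_le_sq_of_abs_le _ huu)
    rw [dotProduct_sub, one_mul] at e2
    have e3 : |tdError Mbar h v'.V (D τ)| ≤ H := abs_tdError_le h (v'.mem_Icc (level_nonneg h)) _
    have e4 : |tdError Mbar h v.V (D τ) - tdError Mbar h v'.V (D τ)| ≤ 2 * (2 * (d * ρ)) :=
      abs_tdError_sub_le h v.measurable v'.measurable (v.mem_Icc (level_nonneg h))
        (v'.mem_Icc (level_nonneg h)) hVV _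
    rw [one_mul] at e1
    exact noise_perturbation hH1 hK1 hdρ0 hdρ e1 (e2.trans hdρ2) e3 (e4.trans_eq (by ring))
  calc _ ≤ ∑ τ, (2 * H * ((PEVI.feat φ D h τ ⬝ᵥ u') * tdError Mbar h v'.V (D τ) / (2 * H)
        - (PEVI.feat φ D h τ ⬝ᵥ u') ^ 2 / 8) + H / 2 * (PEVI.feat φ D h τ ⬝ᵥ u) ^ 2
        + H * (5 / K)) := Finset.sum_le_sum fun τ _ => hterm τ
    _ ≤ 2 * H * L + H / 2 * ∑ τ, (PEVI.feat φ D h τ ⬝ᵥ u) ^ 2 + H * 5 := by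
      rw [Finset.sum_add_distrib, Finset.sum_add_distrib, ← Finset.mul_sum, ← Finset.mul_sum]
      refine add_le_add (add_le_add_left (by gcongr) _) (le_of_eq ?_)
      simp
      field_simp
    -- `1 ≤ L` turns `2 H L + 5 H` into `7 H L`.
    _ ≤ _ := by nlinarith

end UniformNoise

/-! ### Bellman backups in a linear MDP -/

section Linear

open Matrix

variable {S A : Type*} [MeasurableSpace S] [MeasurableSpace A] {d H : ℕ}
  {φ : S × A → EuclideanSpace ℝ (Fin d)}

/-- Integration against a measure given by a signed density. -/
lemma integral_eq_integral_mul_of_real_eq {P : Measure S} [IsFiniteMeasure P] {ν : Measure S}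
    {f : S → ℝ} (hf : Integrable f ν) (hP : ∀ B, MeasurableSet B → P.real B = ∫ x in B, f x ∂ν)
    (V : S → ℝ) : ∫ x, V x ∂P = ∫ x, f x * V x ∂ν := by
  -- The integrals of the signed density are probabilities, so it is nonnegative almost everywhere
  -- and `P` has an ordinary density.
  have hf0 : 0 ≤ᵐ[ν] f := ae_nonneg_of_forall_setIntegral_nonneg hf fun B hB _ => by
    rw [← hP B hB]
    exact measureReal_nonneg
  have h1 : P = ν.withDensity fun x => ENNReal.ofReal (f x) := by
    ext B hB
    rw [withDensity_apply _ hB, ← ofReal_integral_eq_lintegral_ofReal hf.restrict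
      (ae_restrict_of_ae hf0), ← hP B hB, ofReal_measureReal]
  rw [h1, integral_withDensity_eq_integral_toReal_smul₀ hf.aemeasurable.ennreal_ofReal
    (ae_of_all _ fun _ => ENNReal.ofReal_lt_top)]
  refine integral_congr_ae (hf0.mono fun x hx => ?_)
  simp only [smul_eq_mul, ENNReal.toReal_ofReal hx]

/-- In a linear MDP, Bellman backups are linear in the features. -/
lemma MDP.IsLinear.exists_bellman_eq {M : MDP S A} (hM : M.IsLinear H φ) (h : Fin H) {V : S → ℝ}
    {l : ℝ} (hV : Measurable V) (hVl : ∀ x, V x ∈ Set.Icc 0 l) (hl : 0 ≤ l) :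
    ∃ w : Fin d → ℝ, w ⬝ᵥ w ≤ (√d * (1 + l)) ^ 2 ∧
      ∀ z, M.bellman h V z = (φ z).ofLp ⬝ᵥ w := by
  obtain ⟨⟨ν, m, hm, hm1, hP⟩, θ, hθ, hR⟩ := hM.2.2 h h.2
  have hVm : Integrable (fun x => V x • m x) ν :=
    hm.bdd_smul l hV.aestronglyMeasurable (ae_of_all _ fun x => by
      rw [Real.norm_of_nonneg (hVl x).1]; exact (hVl x).2)
  refine ⟨(θ + ∫ x, V x • m x ∂ν).ofLp, ?_, fun z => ?_⟩
  · rw [ofLp_dotProduct_self_eq]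
    refine pow_le_pow_left₀ (norm_nonneg _) ?_ 2
    have h1 : ‖∫ x, V x • m x ∂ν‖ ≤ l * √d := by
      calc ‖∫ x, V x • m x ∂ν‖ ≤ ∫ x, ‖V x • m x‖ ∂ν := norm_integral_le_integral_norm _
        _ ≤ ∫ x, l * ‖m x‖ ∂ν := integral_mono hVm.norm (hm.norm.const_mul l) fun x => by
          dsimp only
          rw [norm_smul, Real.norm_of_nonneg (hVl x).1]
          exact mul_le_mul_of_nonneg_right (hVl x).2 (norm_nonneg _)
        _ = l * ∫ x, ‖m x‖ ∂ν := integral_const_mul _ _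
        _ ≤ l * √d := by gcongr
    calc ‖θ + ∫ x, V x • m x ∂ν‖ ≤ ‖θ‖ + ‖∫ x, V x • m x ∂ν‖ := norm_add_le _ _
      _ ≤ √d + l * √d := add_le_add hθ h1
      _ = _ := by ring
  · have h2 : ∫ x, V x ∂(M.P h z) = inner ℝ (φ z) (∫ x, V x • m x ∂ν) := by
      rw [integral_eq_integral_mul_of_real_eq (hm.const_inner (φ z)) (hP z) V,
        ← integral_inner hVm (φ z)]
      refine integral_congr_ae (ae_of_all _ fun x => ?_)
      simp only [inner_smul_right]
      exact mul_comm _ _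
    rw [MDP.bellman, hR z, h2, ← inner_add_right, EuclideanSpace.inner_eq_star_dotProduct,
      star_trivial, dotProduct_comm]

end Linear

/-! ### Bellman errors of PEVI on the good events -/

namespace PEVI

open Matrix

variable {S A : Type*} [MeasurableSpace S] [MeasurableSpace A] {d K H : ℕ}
  {φ : S × A → EuclideanSpace ℝ (Fin d)} {D : Dataset S A K H} {β : ℝ}

omit [MeasurableSpace S] [MeasurableSpace A] in
lemma feat_dotProduct_self_le (hφ1 : ∀ z, ‖φ z‖ ≤ 1) (h : Fin H) (τ : Fin K) :
    feat φ D h τ ⬝ᵥ feat φ D h τ ≤ 1 := ofLp_dotProduct_self_le_one (hφ1 _)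

-- A crude bound from the contraction property of `Λ⁻¹`; it suffices because the size of the
-- parameter box enters only through a logarithm.
omit [MeasurableSpace S] [MeasurableSpace A] in
lemma abs_weight_le (hφ1 : ∀ z, ‖φ z‖ ≤ 1) (h : Fin H) {V : S → ℝ}
    (hV : ∀ x, V x ∈ Set.Icc 0 ((H : ℝ) - ((h : ℕ) + 1))) (i : Fin d) :
    |weight φ D 1 h V i| ≤ d * K * H := by
  have h1 (j : Fin d) :
      |(∑ τ, (((D τ h).2.2.1 : ℝ) + V (D τ h).2.2.2) • feat φ D h τ) j| ≤ K * H := by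
    rw [Finset.sum_apply]
    calc _ ≤ ∑ τ : Fin K, |((((D τ h).2.2.1 : ℝ) + V (D τ h).2.2.2) • feat φ D h τ) j| :=
          Finset.abs_sum_le_sum_abs _ _
      _ ≤ ∑ _τ : Fin K, (H : ℝ) * 1 := Finset.sum_le_sum fun τ _ => by
          rw [Pi.smul_apply, smul_eq_mul, abs_mul]
          have h2 := hV (D τ h).2.2.2
          have h3 := (D τ h).2.2.1.2
          have h4 : (0 : ℝ) ≤ (h : ℕ) := Nat.cast_nonneg _
          rw [Set.mem_Icc] at h2 h3
          refine mul_le_mul (abs_le.2 ⟨by linarith, by linarith⟩)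
            (abs_apply_le_of_dotProduct_self _ zero_le_one ?_ j) (abs_nonneg _) (by linarith)
          simpa using feat_dotProduct_self_le hφ1 h τ
      _ = K * H := by simp
  have h2 := dotProduct_self_le_sq_of_abs_le _ h1
  rw [← mul_assoc] at h2
  exact abs_apply_le_of_dotProduct_self _ (by positivity)
    (inv_regGram_mulVec_sq_le (feat φ D h) _ h2) i

omit [MeasurableSpace S] [MeasurableSpace A] in
lemma bonus_eq_sqrt (hβ : 0 ≤ β) (h : Fin H) (z : S × A) :
    bonus φ D 1 β h z =
      √((φ z).ofLp ⬝ᵥ (β ^ 2 • (regGram (feat φ D h))⁻¹) *ᵥ (φ z).ofLp) := by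
  rw [smul_mulVec, dotProduct_smul, smul_eq_mul, Real.sqrt_mul (sq_nonneg β), Real.sqrt_sq hβ]
  rfl

/-- Dirac measures as competitors make the greedy average an upper bound for every single action,
and an average exceeds no upper bound. -/
lemma isLUB_of_greedy {h : Fin H} {W : S → ℝ} (hφ : Measurable φ) {q₀ : Measure A}
    [IsProbabilityMeasure q₀] {x : S} {v : ℝ}
    (hq : ∀ q : Measure A, IsProbabilityMeasure q →
      ∫ a, Q φ D 1 β h W (x, a) ∂q ≤ ∫ a, Q φ D 1 β h W (x, a) ∂q₀)
    (hv : v = ∫ a, Q φ D 1 β h W (x, a) ∂q₀) :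
    IsLUB (Set.range fun a => Q φ D 1 β h W (x, a)) v := by
  have hm := measurable_Q (D := D) (lam := 1) (β := β) hφ h W
  have hm' : Measurable fun a => Q φ D 1 β h W (x, a) := by fun_prop
  constructor
  · rintro _ ⟨a, rfl⟩
    have := hq (Measure.dirac a) inferInstance
    rwa [integral_dirac' _ _ hm'.stronglyMeasurable, ← hv] at this
  · intro b hb
    rw [hv]
    calc ∫ a, Q φ D 1 β h W (x, a) ∂q₀ ≤ ∫ _a, b ∂q₀ :=
          integral_mono (integrable_of_mem_Icc hm' fun a => Q_mem_Icc h W (x, a))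
            (integrable_const b) fun a => hb ⟨a, rfl⟩
      _ = b := by simp

/-- The estimated value functions of pessimistic value iteration. -/
lemma exists_pessimisticValue [Nonempty A] (hφ : Measurable φ) (hφ1 : ∀ z, ‖φ z‖ ≤ 1)
    (hβ : 0 ≤ β) {B : ℝ} (hB : d * K * H ≤ B) (hβB : β ^ 2 ≤ B) {π : Policy S A} {V : ℕ → S → ℝ}
    (hH : ∀ x, V H x = 0)
    (hV : ∀ h : Fin H, ∀ x, (∀ q : Measure A, IsProbabilityMeasure q →
      ∫ a, Q φ D 1 β h (V (h + 1)) (x, a) ∂q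
        ≤ ∫ a, Q φ D 1 β h (V (h + 1)) (x, a) ∂(π.act h x)) ∧
      V h x = ∫ a, Q φ D 1 β h (V (h + 1)) (x, a) ∂(π.act h x)) (h : Fin H) :
    ∃ v : PessimisticValue φ ((H : ℝ) - ((h : ℕ) + 1)) B, v.V = V (h + 1) := by
  have hB0 : 0 ≤ B := le_trans (by positivity) hB
  have hbdd : ∀ k ≤ H, ∀ x, V k x ∈ Set.Icc 0 ((H : ℝ) - k) := by
    intro k hk x
    rcases hk.eq_or_lt with rfl | hk
    · simp [hH]
    · rw [(hV ⟨k, hk⟩ x).2]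
      exact integral_mem_Icc fun a => Q_mem_Icc ⟨k, hk⟩ (V (k + 1)) (x, a)
  -- After the last stage the value is zero, which is the clipping level there, so zero parameters
  -- represent it. Otherwise the parameters of `V (h + 1)` come from the regression at stage `h +
  -- 1`.
  rcases (Nat.succ_le_of_lt h.2).eq_or_lt with hh | hh
  · have hl : (H : ℝ) - ((h : ℕ) + 1) = 0 := by
      rw [sub_eq_zero]
      exact_mod_cast hh.symm
    refine ⟨⟨0, 0, V (h + 1), fun _ => by simpa using hB0, fun _ _ => by simpa using hB0, ?_, fun x => ?_⟩, rfl⟩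
    · have : V (h + 1) = fun _ => 0 := funext fun x => by
        have := hH x
        rwa [← hh] at this
      rw [this]
      exact measurable_const
    · have h0 : V (h + 1) x = 0 := by
        have := hH x
        rwa [← hh] at this
      rw [h0, hl]
      simp [clip]
  · let k : Fin H := ⟨h + 1, hh⟩
    have hl : (H : ℝ) - ((h : ℕ) + 1) = (H : ℝ) - (k : ℕ) := by simp [k]
    have hbdd' (x) : V (k + 1) x ∈ Set.Icc 0 ((H : ℝ) - ((k : ℕ) + 1)) := by
      simpa using hbdd (k + 1) k.2 x
    refine ⟨⟨weight φ D 1 k (V (k + 1)), β ^ 2 • (regGram (feat φ D k))⁻¹, V (h + 1),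
      fun i => (abs_weight_le hφ1 k hbdd' i).trans hB, fun i j => ?_, ?_, fun x => ?_⟩, rfl⟩
    · rw [Matrix.smul_apply, smul_eq_mul, abs_mul, abs_of_nonneg (sq_nonneg β)]
      exact (mul_le_of_le_one_right (sq_nonneg β) (abs_inv_regGram_apply_le _ i j)).trans hβB
    · rw [show V (h + 1) = fun x => ∫ a, Q φ D 1 β k (V (k + 1)) (x, a) ∂(π.act k x) from
        funext fun x => (hV k x).2]
      exact ((measurable_Q hφ k (V (k + 1))).stronglyMeasurable.integral_kernel_prod_right'
        (κ := π.act k)).measurable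
    · have := isLUB_of_greedy hφ (hV k x).1 (hV k x).2
      simp only [Q_eq_clip, bonus_eq_sqrt hβ] at this
      rw [hl]
      exact this

/-- On the event that the noise is small and the empirical covariance is large, the Bellman errors
of pessimistic value iteration are small. -/
lemma abs_bellman_sub_Q_le {M : MDP S A} (hM : M.IsLinear H φ) (hβ : 0 ≤ β) (h : Fin H)
    {V : S → ℝ} (hV : Measurable V) (hVl : ∀ x, V x ∈ Set.Icc 0 ((H : ℝ) - ((h : ℕ) + 1)))
    {κ L : ℝ} (hκ : 0 < κ) (hL : 0 < L)
    (hcov : ∀ u, κ * (u ⬝ᵥ u) ≤ ∑ τ, (feat φ D h τ ⬝ᵥ u) ^ 2)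
    (hnoise : ∀ u : Fin d → ℝ, u ⬝ᵥ u ≤ L →
      ∑ τ, tdError M h V (D τ) * (feat φ D h τ ⬝ᵥ u) ≤
        H * ((∑ τ, (feat φ D h τ ⬝ᵥ u) ^ 2) / 2 + 7 * L)) (z : S × A) :
    |M.bellman h V z - Q φ D 1 β h V z| ≤ 1 / √κ * (8 * H * √L + √d * H + β) := by
  obtain ⟨w, hw, hwz⟩ := hM.exists_bellman_eq h hV hVl (level_nonneg h)
  have hx := ofLp_dotProduct_self_le_one (hM.2.1 z)
  have h4 : (0 : ℝ) ≤ (h : ℕ) := Nat.cast_nonneg _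
  have hbell : M.bellman h V z ∈ Set.Icc 0 ((H : ℝ) - (h : ℕ)) := by
    have := M.bellman_mem_Icc h hVl z
    exact ⟨this.1, this.2.trans (by linarith)⟩
  have h1 := abs_dotProduct_inv_regGram_sub_le (feat φ D h)
    (fun τ => ((D τ h).2.2.1 : ℝ) + V (D τ h).2.2.2) (φ z).ofLp w hL (Nat.cast_nonneg H)
    (W := √d * H) (by positivity) (hw.trans (by
      have := level_nonneg h
      gcongr
      linarith)) (fun u hu => by
        refine le_trans (le_of_eq (Finset.sum_congr rfl fun τ _ => ?_)) (hnoise u hu)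
        rw [tdError, hwz]
        rfl)
  have h2 := sqrt_dotProduct_inv_regGram_le (feat φ D h) (φ z).ofLp hx hκ hcov
  -- The exact backup already lies in the clipping range, so clipping the estimate cannot increase
  -- the error.
  rw [Q_eq_clip, ← clip_of_mem hbell]
  refine (abs_clip_sub_clip_le _ _ _).trans ?_
  rw [hwz z, abs_sub_comm]
  set b := √((φ z).ofLp ⬝ᵥ (regGram (feat φ D h))⁻¹ *ᵥ (φ z).ofLp) with hb
  have hb0 : 0 ≤ b := Real.sqrt_nonneg _
  -- At `lam = 1`, `gram` unfolds to `regGram` of the features.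
  have h3 : bonus φ D 1 β h z = β * b := rfl
  have h5 : (φ z).ofLp ⬝ᵥ weight φ D 1 h V = (φ z).ofLp ⬝ᵥ (regGram (feat φ D h))⁻¹ *ᵥ
      ∑ τ, (((D τ h).2.2.1 : ℝ) + V (D τ h).2.2.2) • feat φ D h τ := rfl
  rw [h3, h5]
  calc _ = |((φ z).ofLp ⬝ᵥ (regGram (feat φ D h))⁻¹ *ᵥ
        ∑ τ, (((D τ h).2.2.1 : ℝ) + V (D τ h).2.2.2) • feat φ D h τ - (φ z).ofLp ⬝ᵥ w)
          - β * b| := by congr 1; ring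
    -- The bonus is counted as an error like the others, so `β` need not dominate the regression
    -- error.
    _ ≤ _ + |β * b| := abs_sub _ _
    _ ≤ b * (8 * H * √L + √d * H) + β * b := by
      rw [abs_of_nonneg (mul_nonneg hβ hb0)]
      exact add_le_add_left h1 _
    _ = b * (8 * H * √L + √d * H + β) := by ring
    _ ≤ _ := by gcongr

end PEVI

/-! ### From the average MDP to the contextual problem -/

section Assembly

variable {C S A : Type*} [MeasurableSpace C] [MeasurableSpace S] [MeasurableSpace A]

lemma bddAbove_range_of_le {ι : Type*} {f : ι → ℝ} {b : ℝ} (h : ∀ i, f i ≤ b) :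
    BddAbove (Set.range f) := ⟨b, by rintro _ ⟨i, rfl⟩; exact h i⟩

lemma ContextualMDP.meanValue_mem_Icc (M : ContextualMDP C S A) (p : Measure C)
    [IsProbabilityMeasure p] (H : ℕ) (x₁ : S) (π : Policy S A) :
    M.meanValue p H x₁ π ∈ Set.Icc (0 : ℝ) H :=
  integral_mem_Icc fun c => (M.mdp c).value_mem_Icc π H 0 x₁

lemma MDP.iSup_value_sub_le_horizon (N : MDP S A) (H : ℕ) (x₁ : S) (π : Policy S A) :
    (⨆ π' : Policy S A, N.value π' H 0 x₁) - N.value π H 0 x₁ ≤ H := by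
  have : Nonempty (Policy S A) := ⟨π⟩
  have h1 : (⨆ π' : Policy S A, N.value π' H 0 x₁) ≤ H :=
    ciSup_le fun π' => (N.value_mem_Icc π' H 0 x₁).2
  linarith [(N.value_mem_Icc π H 0 x₁).1]

lemma ContextualMDP.subOpt_le_horizon (M : ContextualMDP C S A) (p : Measure C)
    [IsProbabilityMeasure p] (H : ℕ) (x₁ : S) (π : Policy S A) : M.subOpt p H x₁ π ≤ H := by
  have : Nonempty (Policy S A) := ⟨π⟩
  have h1 : (⨆ π' : Policy S A, M.meanValue p H x₁ π') ≤ H :=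
    ciSup_le fun π' => (M.meanValue_mem_Icc p H x₁ π').2
  rw [ContextualMDP.subOpt]
  linarith [(M.meanValue_mem_Icc p H x₁ π).1]

/-- The zero-shot generalization gap is bounded by the suboptimality in another MDP and the
largest difference of the values. -/
lemma ContextualMDP.subOpt_le (M : ContextualMDP C S A) (p : Measure C)
    [IsProbabilityMeasure p] (N : MDP S A) (H : ℕ) (x₁ : S) (π : Policy S A) :
    M.subOpt p H x₁ π ≤ ((⨆ π' : Policy S A, N.value π' H 0 x₁) - N.value π H 0 x₁)
      + 2 * ⨆ π' : Policy S A, |N.value π' H 0 x₁ - M.meanValue p H x₁ π'| := by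
  have : Nonempty (Policy S A) := ⟨π⟩
  have hdiff (π' : Policy S A) : |N.value π' H 0 x₁ - M.meanValue p H x₁ π'| ≤
      ⨆ π' : Policy S A, |N.value π' H 0 x₁ - M.meanValue p H x₁ π'| :=
    le_ciSup (f := fun π' : Policy S A => |N.value π' H 0 x₁ - M.meanValue p H x₁ π'|)
      (bddAbove_range_of_le (b := H) fun π' => by
        have h1 := N.value_mem_Icc π' H 0 x₁
        have h2 := M.meanValue_mem_Icc p H x₁ π'
        rw [Set.mem_Icc] at h1 h2
        rw [abs_le]
        constructor <;> linarith) π'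
  have hval (π' : Policy S A) : N.value π' H 0 x₁ ≤ ⨆ π' : Policy S A, N.value π' H 0 x₁ :=
    le_ciSup (f := fun π' : Policy S A => N.value π' H 0 x₁)
      (bddAbove_range_of_le fun π' => (N.value_mem_Icc π' H 0 x₁).2) π'
  have h1 : (⨆ π' : Policy S A, M.meanValue p H x₁ π') ≤ (⨆ π' : Policy S A, N.value π' H 0 x₁)
      + ⨆ π' : Policy S A, |N.value π' H 0 x₁ - M.meanValue p H x₁ π'| :=
    ciSup_le fun π' => by linarith [hval π', (abs_le.1 (hdiff π')).1]
  rw [ContextualMDP.subOpt]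
  linarith [(abs_le.1 (hdiff π)).2]

/-- In dimension zero all inner products vanish, whereas a transition kernel has mass one. -/
lemma MDP.IsLinear.dim_pos {N : MDP S A} {d H : ℕ} {φ : S × A → EuclideanSpace ℝ (Fin d)}
    (hN : N.IsLinear H φ) (hH : 0 < H) (z : S × A) : 0 < d := by
  rcases Nat.eq_zero_or_pos d with rfl | hd
  · obtain ⟨⟨ν, m, -, -, hP⟩, -⟩ := hN.2.2 0 hH
    have h1 := hP z Set.univ MeasurableSet.univ
    have h2 (x) : inner ℝ (φ z) (m x) = 0 := by
      rw [Subsingleton.elim (m x) 0, inner_zero_right]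
    simp [h2] at h1
  · exact hd

/-- The guarantee for pessimistic value iteration in the average MDP, in terms of the
bounds on the two deviation events. -/
lemma exists_event_suboptimality {M : ContextualMDP C S A} {p : Measure C}
    [IsProbabilityMeasure p] {πb : Policy S A} {x₁ : S} {d H K : ℕ} {Mbar : MDP S A}
    {φ : S × A → EuclideanSpace ℝ (Fin d)} [Nonempty A] (hM : M.IsAverage p πb x₁ H Mbar) {c : ℝ}
    (hc : 0 < c) (hE : Mbar.WellExplored πb H x₁ φ c) (hd : 0 < d) (hH : 0 < H) (hK : 0 < K)
    {β B L δ : ℝ} (hβ : 0 ≤ β) (hB : d * K * H ≤ B) (hβB : β ^ 2 ≤ B) (hδ : 0 < δ) (hL1 : 1 ≤ L)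
    (hL : Real.log (H * (32 * B * K ^ 4 * d ^ 2 + 2) ^ (2 * d + d ^ 2) / (δ / 2)) ≤ L)
    (hLK : L ≤ K)
    (hKc : 8 * Real.log (H * (16 * d ^ 2 / c + 2) ^ d / (δ / 2)) * (d ^ 2 / c ^ 2) ≤ K) :
    ∃ E : Set (Dataset S A K H), MeasurableSet E ∧
      ENNReal.ofReal (1 - δ) ≤ M.datasetLaw p πb x₁ K H E ∧
      ∀ D ∈ E, ∀ π : Policy S A, PEVI.IsOutput φ D 1 β π →
        (⨆ π' : Policy S A, Mbar.value π' H 0 x₁) - Mbar.value π H 0 x₁ ≤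
          2 * H * (1 / √(K * c / (2 * d)) * (8 * H * √L + √d * H + β)) := by
  have hφ := hE.1.1
  have hφ1 := hE.1.2.1
  have hK1 : (1 : ℝ) ≤ K := by exact_mod_cast hK
  have hd1 : (1 : ℝ) ≤ d := by exact_mod_cast hd
  have hH1 : (1 : ℝ) ≤ H := by exact_mod_cast hH
  have hKB : (K : ℝ) ≤ B := by
    refine le_trans ?_ hB
    calc (K : ℝ) = 1 * K * 1 := by ring
      _ ≤ d * K * H := by gcongr
  obtain ⟨E₁, hE₁m, hE₁p, hE₁⟩ := exists_event_covariance hM hc hE hd hH K (half_pos hδ) hKc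
  obtain ⟨E₂, hE₂m, hE₂p, hE₂⟩ := exists_event_noise hM hφ hφ1 hd hH hK hKB (half_pos hδ) hL1 hL
  have hprob : IsProbabilityMeasure (M.datasetLaw p πb x₁ K H) := by
    unfold ContextualMDP.datasetLaw
    infer_instance
  refine ⟨E₁ ∩ E₂, hE₁m.inter hE₂m, ?_, fun D hD π hπ => ?_⟩
  · have h1 : M.datasetLaw p πb x₁ K H (E₁ ∩ E₂)ᶜ ≤ ENNReal.ofReal δ := by
      rw [Set.compl_inter]
      calc _ ≤ _ := measure_union_le _ _
        _ ≤ ENNReal.ofReal (δ / 2) + ENNReal.ofReal (δ / 2) := add_le_add hE₁p hE₂p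
        _ = ENNReal.ofReal δ := by
          rw [← ENNReal.ofReal_add (half_pos hδ).le (half_pos hδ).le, add_halves]
    rw [prob_compl_eq_one_sub (hE₁m.inter hE₂m), tsub_le_iff_right] at h1
    rw [ENNReal.ofReal_sub _ hδ.le, ENNReal.ofReal_one, tsub_le_iff_right, add_comm]
    exact h1
  · obtain ⟨V, hVH, hV⟩ := hπ
    have : Nonempty (Policy S A) := ⟨π⟩
    have herr (h : Fin H) (z : S × A) :
        |Mbar.bellman h (V (h + 1)) z - PEVI.Q φ D 1 β h (V (h + 1)) z| ≤
          1 / √(K * c / (2 * d)) * (8 * H * √L + √d * H + β) := by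
      obtain ⟨v, hv⟩ := PEVI.exists_pessimisticValue hφ hφ1 hβ hB hβB hVH hV h
      rw [← hv]
      refine PEVI.abs_bellman_sub_Q_le hE.1 hβ h v.measurable (v.mem_Icc (level_nonneg h))
        (by positivity) (by linarith) (hE₁ D hD.1 h) (fun u hu => hE₂ D hD.2 h v u ?_) z
      -- `u ⬝ᵥ u ≤ L ≤ K ≤ K ^ 2`, the range of directions covered by the net.
      nlinarith
    have h2 (π') := PEVI.value_sub_value_le hφ Mbar hVH hV herr π' x₁
    rw [sub_le_iff_le_add]
    exact ciSup_le fun π' => by linarith [h2 π']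

end Assembly

/-! ### Covering numbers and constants -/

section Constants

/-- A base that is polynomial in `q` makes the logarithm of the covering number linear in `log q`,
with the number of parameters as a factor. -/
lemma log_covering_le {h X δ q a : ℝ} {n k : ℕ} (hh : 0 < h) (hX : 0 < X) (hδ : 0 < δ)
    (hq : 0 < q) (ha : 0 < a) (hhq : h / (δ / 2) ≤ q) (hXq : X ≤ a * q ^ k) :
    Real.log (h * X ^ n / (δ / 2)) ≤ Real.log q + n * (Real.log a + k * Real.log q) := by
  have h1 : h * X ^ n / (δ / 2) ≤ q * (a * q ^ k) ^ n := by
    calc h * X ^ n / (δ / 2) = h / (δ / 2) * X ^ n := by ring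
      _ ≤ q * (a * q ^ k) ^ n := by gcongr
  refine (Real.log_le_log (by positivity) h1).trans (le_of_eq ?_)
  rw [Real.log_mul hq.ne' (by positivity), Real.log_pow, Real.log_mul ha.ne' (by positivity),
    Real.log_pow]

variable {d H K : ℕ} {δ : ℝ}

/-- The quantity `4 d H K / δ` dominates all parameters. -/
lemma param_bounds (hd : 0 < d) (hH : 0 < H) (hK : 0 < K) (hδ : 0 < δ) (hδ1 : δ < 1) :
    (d : ℝ) ≤ 4 * d * H * K / δ ∧ (H : ℝ) ≤ 4 * d * H * K / δ ∧ (K : ℝ) ≤ 4 * d * H * K / δ ∧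
      (H : ℝ) / (δ / 2) ≤ 4 * d * H * K / δ ∧ 1 ≤ 4 * d * H * K / δ ∧
      1 ≤ Real.log (4 * d * H * K / δ) ∧
      Real.log (4 * d * H * K / δ) ≤ 4 * d * H * K / δ := by
  have hK1 : (1 : ℝ) ≤ K := by exact_mod_cast hK
  have hd1 : (1 : ℝ) ≤ d := by exact_mod_cast hd
  have hH1 : (1 : ℝ) ≤ H := by exact_mod_cast hH
  have hdH : (1 : ℝ) ≤ d * H := one_le_mul_of_one_le_of_one_le hd1 hH1
  have hdK : (1 : ℝ) ≤ d * K := one_le_mul_of_one_le_of_one_le hd1 hK1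
  have hHK : (1 : ℝ) ≤ H * K := one_le_mul_of_one_le_of_one_le hH1 hK1
  have hdHK : (1 : ℝ) ≤ d * H * K := one_le_mul_of_one_le_of_one_le hdH hK1
  have h0 : 4 * (d : ℝ) * H * K ≤ 4 * d * H * K / δ := by
    rw [le_div_iff₀ hδ]
    exact mul_le_of_le_one_right (by positivity) hδ1.le
  have h4 : 4 ≤ 4 * (d : ℝ) * H * K / δ := by linarith
  refine ⟨?_, ?_, ?_, ?_, by linarith, ?_, Real.log_le_self (by linarith)⟩
  · nlinarith
  · nlinarith
  · nlinarith
  · rw [div_div_eq_mul_div]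
    refine div_le_div_of_nonneg_right ?_ hδ.le
    nlinarith
  · rw [Real.le_log_iff_exp_le (by linarith)]
    linarith [Real.exp_one_lt_d9]

/-- With `q = 4 d H K / δ`, each of `d`, `H`, `K` and `log q` is at most `q`, so the base is at most
`(34 + 32 c'²) q ^ 11`. The exponent is at most `3 d ^ 2`, and `34 = 1 + 3 * 11`. -/
lemma log_noise_covering_le (hd : 0 < d) (hH : 0 < H) (hK : 0 < K) (hδ : 0 < δ) (hδ1 : δ < 1)
    (c' : ℝ) :
    Real.log (H * (32 * (d * K * H + (c' * d * H * √(Real.log (4 * d * H * K / δ))) ^ 2) * K ^ 4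
      * d ^ 2 + 2) ^ (2 * d + d ^ 2) / (δ / 2)) ≤
      (34 + 3 * Real.log (34 + 32 * c' ^ 2)) * d ^ 2 * Real.log (4 * d * H * K / δ) := by
  obtain ⟨hdq, hHq, hKq, hHδ, hq1, hl1, hlq⟩ := param_bounds hd hH hK hδ hδ1
  have hd1 : (1 : ℝ) ≤ d := by exact_mod_cast hd
  have hH0 : (0 : ℝ) < H := by exact_mod_cast hH
  have hK0 : (0 : ℝ) < K := by exact_mod_cast hK
  set q : ℝ := 4 * d * H * K / δ
  have hq0 : 0 < q := by linarith
  have ha : 0 ≤ Real.log (34 + 32 * c' ^ 2) := Real.log_nonneg (by nlinarith [sq_nonneg c'])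
  have h1 : d * K * H + (c' * d * H * √(Real.log q)) ^ 2 ≤ (1 + c' ^ 2) * q ^ 5 := by
    have h2 : (d : ℝ) * K * H ≤ q ^ 5 := by
      calc (d : ℝ) * K * H ≤ q * q * q := by gcongr
        _ = q ^ 3 := by ring
        _ ≤ q ^ 5 := pow_le_pow_right₀ hq1 (by norm_num)
    have h3 : (c' * d * H * √(Real.log q)) ^ 2 ≤ c' ^ 2 * q ^ 5 := by
      rw [mul_pow, mul_pow, mul_pow, Real.sq_sqrt (by linarith)]
      calc c' ^ 2 * (d : ℝ) ^ 2 * H ^ 2 * Real.log q ≤ c' ^ 2 * q ^ 2 * q ^ 2 * q := by gcongr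
        _ = c' ^ 2 * q ^ 5 := by ring
    linarith
  have h2 : 32 * (d * K * H + (c' * d * H * √(Real.log q)) ^ 2) * K ^ 4 * d ^ 2 + 2 ≤
      (34 + 32 * c' ^ 2) * q ^ 11 := by
    have h3 : 1 ≤ q ^ 11 := one_le_pow₀ hq1
    calc _ ≤ 32 * ((1 + c' ^ 2) * q ^ 5) * q ^ 4 * q ^ 2 + 2 * q ^ 11 := by gcongr; linarith
      _ = _ := by ring
  refine (log_covering_le hH0 (by positivity) hδ hq0 (by positivity) hHδ h2).trans ?_
  push_cast
  set l := Real.log q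
  set α := Real.log (34 + 32 * c' ^ 2)
  have hd2 : (d : ℝ) ≤ d ^ 2 := le_self_pow₀ hd1 two_ne_zero
  have h4 : (2 * (d : ℝ) + d ^ 2) * (α + 11 * l) ≤ (3 * d ^ 2) * (α * l + 11 * l) := by
    gcongr
    · linarith
    · exact le_mul_of_one_le_right ha hl1
  have h5 : l ≤ d ^ 2 * l := le_mul_of_one_le_left (by linarith) (one_le_pow₀ hd1)
  calc _ ≤ d ^ 2 * l + (3 * d ^ 2) * (α * l + 11 * l) := add_le_add h5 h4
    _ = _ := by ring

lemma log_direction_covering_le (hd : 0 < d) (hH : 0 < H) (hK : 0 < K) (hδ : 0 < δ) (hδ1 : δ < 1)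
    {c : ℝ} (hc : 0 < c) :
    Real.log (H * (16 * d ^ 2 / c + 2) ^ d / (δ / 2)) ≤
      (3 + Real.log (16 / c + 2)) * d * Real.log (4 * d * H * K / δ) := by
  obtain ⟨hdq, -, -, hHδ, hq1, hl1, -⟩ := param_bounds hd hH hK hδ hδ1
  have hd1 : (1 : ℝ) ≤ d := by exact_mod_cast hd
  have hH0 : (0 : ℝ) < H := by exact_mod_cast hH
  set q : ℝ := 4 * d * H * K / δ
  have hq0 : 0 < q := by linarith
  have ha : 0 ≤ Real.log (16 / c + 2) := Real.log_nonneg (by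
    have : 0 < 16 / c := by positivity
    linarith)
  have h2 : 16 * (d : ℝ) ^ 2 / c + 2 ≤ (16 / c + 2) * q ^ 2 := by
    have h3 : 1 ≤ q ^ 2 := one_le_pow₀ hq1
    calc _ ≤ 16 * q ^ 2 / c + 2 * q ^ 2 := by gcongr; linarith
      _ = _ := by ring
  refine (log_covering_le hH0 (by positivity) hδ hq0 (by positivity) hHδ h2).trans ?_
  push_cast
  set l := Real.log q
  set α := Real.log (16 / c + 2)
  have h4 : (d : ℝ) * (α + 2 * l) ≤ d * (α * l + 2 * l) := by
    gcongr
    exact le_mul_of_one_le_right ha hl1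
  have h5 : l ≤ d * l := le_mul_of_one_le_left (by linarith) hd1
  calc _ ≤ d * l + d * (α * l + 2 * l) := add_le_add h5 h4
    _ = _ := by ring

/-- The accumulated Bellman error is of the order of the claimed rate. -/
lemma accumulated_error_le (hd : 0 < d) (hH : 0 < H) (hK : 0 < K) {c c' CL l : ℝ} (hc : 0 < c)
    (hCL : 0 ≤ CL) (hl : 1 ≤ l) :
    2 * H * (1 / √(K * c / (2 * d)) * (8 * H * √(CL * d ^ 2 * l) + √d * H + c' * d * H * √l)) ≤
      2 * √(2 / c) * (8 * √CL + 1 + c') * ((d : ℝ) ^ (3 / 2 : ℝ) * (H : ℝ) ^ 2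
        * (K : ℝ) ^ (-(1 / 2) : ℝ) * √l) := by
  have hK0 : (0 : ℝ) < K := by exact_mod_cast hK
  have hd0 : (0 : ℝ) < d := by exact_mod_cast hd
  have hd1 : (1 : ℝ) ≤ d := by exact_mod_cast hd
  have hK12 : (K : ℝ) ^ (-(1 / 2) : ℝ) = 1 / √K := by
    rw [Real.rpow_neg hK0.le, ← Real.sqrt_eq_rpow, one_div]
  have hd32 : (d : ℝ) ^ (3 / 2 : ℝ) = d * √d := by
    rw [Real.sqrt_eq_rpow, ← Real.rpow_one_add' hd0.le (by norm_num)]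
    norm_num
  have h1 : 1 / √(K * c / (2 * d)) = √(2 / c) * √d / √K := by
    rw [← Real.sqrt_mul (by positivity), ← Real.sqrt_div (by positivity),
      ← Real.sqrt_one, ← Real.sqrt_div zero_le_one]
    congr 1
    field_simp
  have h2 : √(CL * d ^ 2 * l) = √CL * d * √l := by
    rw [Real.sqrt_mul (by positivity), Real.sqrt_mul hCL, Real.sqrt_sq hd0.le]
  have h3 : √(d : ℝ) * H ≤ d * H * √l := by
    have h4 : √(d : ℝ) ≤ d := Real.sqrt_le_iff.2 ⟨hd0.le, by nlinarith⟩
    have h5 : 1 ≤ √l := Real.one_le_sqrt.2 hl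
    calc √(d : ℝ) * H = √(d : ℝ) * H * 1 := by ring
      _ ≤ d * H * √l := by gcongr
  rw [h1, h2, hK12, hd32]
  calc _ ≤ 2 * H * (√(2 / c) * √d / √K *
        (8 * H * (√CL * d * √l) + d * H * √l + c' * d * H * √l)) := by gcongr
    _ = _ := by ring

/-- Squaring gives `K ≥ C² H² d³ l`. Since no value exceeds `H`, the theorem has content only when
the rate is below `H`, and then `K` is automatically this large. -/
lemma le_of_rate_lt (hd : 0 < d) (hH : 0 < H) (hK : 0 < K) {C l : ℝ} (hC : 1 ≤ C) (hl : 0 ≤ l)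
    (h : C * (d : ℝ) ^ (3 / 2 : ℝ) * (H : ℝ) ^ 2 * (K : ℝ) ^ (-(1 / 2) : ℝ) * √l < H) :
    C * (d ^ 3 * l) ≤ K := by
  have hK0 : (0 : ℝ) < K := by exact_mod_cast hK
  have hd0 : (0 : ℝ) < d := by exact_mod_cast hd
  have hH1 : (1 : ℝ) ≤ H := by exact_mod_cast hH
  have hsq : (C * (d : ℝ) ^ (3 / 2 : ℝ) * (H : ℝ) ^ 2 * (K : ℝ) ^ (-(1 / 2) : ℝ) * √l) ^ 2 ≤
      (H : ℝ) ^ 2 := pow_le_pow_left₀ (by positivity) h.le 2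
  have e1 : ((d : ℝ) ^ (3 / 2 : ℝ)) ^ 2 = d ^ 3 := by
    rw [← Real.rpow_natCast, ← Real.rpow_mul hd0.le, ← Real.rpow_natCast]
    norm_num
  have e2 : ((K : ℝ) ^ (-(1 / 2) : ℝ)) ^ 2 = (K : ℝ)⁻¹ := by
    rw [← Real.rpow_natCast, ← Real.rpow_mul hK0.le, ← Real.rpow_neg_one]
    norm_num
  rw [mul_pow, mul_pow, mul_pow, mul_pow, e1, e2, Real.sq_sqrt hl] at hsq
  have h2 : C ^ 2 * (H : ℝ) ^ 2 * (d ^ 3 * l) ≤ K := by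
    have h3 : (C ^ 2 * (H : ℝ) ^ 2 * (d ^ 3 * l)) * ((H : ℝ) ^ 2 * (K : ℝ)⁻¹) ≤
        K * ((H : ℝ) ^ 2 * (K : ℝ)⁻¹) := by
      calc _ = C ^ 2 * (d : ℝ) ^ 3 * ((H : ℝ) ^ 2) ^ 2 * (K : ℝ)⁻¹ * l := by ring
        _ ≤ (H : ℝ) ^ 2 := hsq
        _ = _ := by field_simp
    exact le_of_mul_le_mul_right h3 (by positivity)
  refine le_trans ?_ h2
  gcongr
  calc C = C * 1 * 1 := by ring
    _ ≤ C * C * H ^ 2 := by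
      gcongr
      exact one_le_pow₀ hH1
    _ = _ := by ring

end Constants

end
end OfflineRL
-- The theorem
theorem theorem4 (c : ℝ) (hc : 0 < c) :
    ∃ ct : ℝ, 0 < ct ∧ ∀ c' : ℝ, 0 < c' → ∃ c'' : ℝ, 0 < c'' ∧
      ∀ (C S A : Type*) [MeasurableSpace C] [MeasurableSpace S] [MeasurableSpace A]
        (p : Measure C) [IsProbabilityMeasure p] (M : ContextualMDP C S A) (x₁ : S)
        (d H K : ℕ) (φ : S × A → EuclideanSpace ℝ (Fin d)) (πb : Policy S A)
        (Mbar : MDP S A) (δ : ℝ),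
        M.IsAverage p πb x₁ H Mbar →
        Mbar.WellExplored πb H x₁ φ c →
        0 < δ → δ < 1 →
        ct * d * Real.log (4 * d * H / δ) ≤ K →
        ∃ E : Set (Dataset S A K H), MeasurableSet E ∧
          ENNReal.ofReal (1 - δ) ≤ M.datasetLaw p πb x₁ K H E ∧
          ∀ D ∈ E, ∀ π : Policy S A,
            PEVI.IsOutput φ D 1 (c' * d * H * √(Real.log (4 * d * H * K / δ))) π →
            (⨆ π' : Policy S A, Mbar.value π' H 0 x₁) - Mbar.value π H 0 x₁
              ≤ c'' * (d : ℝ) ^ (3 / 2 : ℝ) * (H : ℝ) ^ 2 * (K : ℝ) ^ (-(1 / 2) : ℝ)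
                  * √(Real.log (4 * d * H * K / δ)) ∧
            M.subOpt p H x₁ π
              ≤ c'' * (d : ℝ) ^ (3 / 2 : ℝ) * (H : ℝ) ^ 2 * (K : ℝ) ^ (-(1 / 2) : ℝ)
                  * √(Real.log (4 * d * H * K / δ))
                + 2 * ⨆ π' : Policy S A, |Mbar.value π' H 0 x₁ - M.meanValue p H x₁ π'| := by
  let CL : ℝ → ℝ := fun c' => 34 + 3 * Real.log (34 + 32 * c' ^ 2)
  let C₂ : ℝ := 3 + Real.log (16 / c + 2)
  have hC₂ : 0 ≤ C₂ := by
    have : 0 < 16 / c := by positivity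
    have := Real.log_nonneg (show 1 ≤ 16 / c + 2 by linarith)
    positivity
  -- Any positive constant would do, since the assumed lower bound on `K` serves only to make `K`
  -- positive; the sample size needed for concentration comes from `le_of_rate_lt`.
  refine ⟨1, one_pos, fun c' hc' => ?_⟩
  have hCL : 1 ≤ CL c' := by
    have := Real.log_nonneg (show 1 ≤ 34 + 32 * c' ^ 2 by nlinarith)
    simp only [CL]
    linarith
  let C₀ : ℝ := 2 * √(2 / c) * (8 * √(CL c') + 1 + c')
  have hC₀ : 0 ≤ C₀ := by positivity
  -- `C₀` bounds the accumulated error. The remaining summands ensure that `K ≥ C₁ d³ l` implies `L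
  -- ≤ K` and the sample size for the covariance event, and that `C₁ ≥ 1`.
  let C₁ : ℝ := C₀ + (1 + CL c' + 8 * C₂ / c ^ 2)
  have h8 : 0 ≤ 8 * C₂ / c ^ 2 := by positivity
  have hC₁ : 1 ≤ C₁ := by simp only [C₁]; linarith
  refine ⟨C₁, by linarith, ?_⟩
  intro C S A _ _ _ p _ M x₁ d H K φ πb Mbar δ hM hE hδ hδ1 hK
  set l := Real.log (4 * d * H * K / δ) with hl
  set R : ℝ := C₁ * (d : ℝ) ^ (3 / 2 : ℝ) * (H : ℝ) ^ 2 * (K : ℝ) ^ (-(1 / 2) : ℝ) * √l with hR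
  have hsup (π : Policy S A) :
      0 ≤ ⨆ π' : Policy S A, |Mbar.value π' H 0 x₁ - M.meanValue p H x₁ π'| :=
    Real.iSup_nonneg fun π' => abs_nonneg _
  rcases le_or_gt (H : ℝ) R with htriv | hnt
  · refine ⟨Set.univ, MeasurableSet.univ, ?_, fun D _ π _ => ⟨?_, ?_⟩⟩
    · have : IsProbabilityMeasure (M.datasetLaw p πb x₁ K H) := by
        unfold ContextualMDP.datasetLaw
        infer_instance
      rw [measure_univ, ← ENNReal.ofReal_one]
      exact ENNReal.ofReal_le_ofReal (by linarith)
    · exact (Mbar.iSup_value_sub_le_horizon H x₁ π).trans htriv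
    · linarith [M.subOpt_le_horizon p H x₁ π, hsup π]
  have hR0 : 0 ≤ R := by positivity
  have hH : 0 < H := by exact_mod_cast hR0.trans_lt hnt
  -- A Markov kernel into an empty action space would have total mass zero.
  have hA : Nonempty A := by
    by_contra hne
    rw [not_nonempty_iff] at hne
    have := measure_univ (μ := πb.act 0 x₁)
    rw [Set.univ_eq_empty_iff.2 hne, measure_empty] at this
    exact zero_ne_one this
  have hd : 0 < d := hE.1.dim_pos hH (x₁, Classical.arbitrary A)
  -- The case distinction does not exclude `K = 0`, because `0 ^ (-(1 / 2))` is `0` and makes the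
  -- rate vanish.
  have hK0 : 0 < K := by
    have hd1 : (1 : ℝ) ≤ d := by exact_mod_cast hd
    have hH1 : (1 : ℝ) ≤ H := by exact_mod_cast hH
    have h1 : 1 < 4 * (d : ℝ) * H / δ := by
      rw [lt_div_iff₀ hδ]
      nlinarith
    have h2 : 0 < 1 * d * Real.log (4 * d * H / δ) := by
      have := Real.log_pos h1
      positivity
    exact_mod_cast h2.trans_le hK
  obtain ⟨-, -, -, -, -, hl1, -⟩ := param_bounds hd hH hK0 hδ hδ1
  have hd1 : (1 : ℝ) ≤ d := by exact_mod_cast hd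
  have hKl : C₁ * (d ^ 3 * l) ≤ K := le_of_rate_lt hd hH hK0 hC₁ (by linarith) hnt
  have hdl : (1 : ℝ) ≤ d ^ 2 * l := one_le_mul_of_one_le_of_one_le (one_le_pow₀ hd1) hl1
  obtain ⟨E, hEm, hEp, hEs⟩ := exists_event_suboptimality hM hc hE hd hH hK0
    (β := c' * d * H * √l) (B := d * K * H + (c' * d * H * √l) ^ 2) (L := CL c' * d ^ 2 * l)
    (by positivity) (le_add_of_nonneg_right (sq_nonneg _))
    (le_add_of_nonneg_left (by positivity)) hδ
    (by rw [mul_assoc]; exact one_le_mul_of_one_le_of_one_le hCL hdl)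
    (log_noise_covering_le hd hH hK0 hδ hδ1 c')
    (by
      refine le_trans ?_ hKl
      have h1 : CL c' ≤ C₁ := by simp only [C₁]; linarith
      have h2 : (d : ℝ) ^ 2 ≤ d ^ 3 := pow_le_pow_right₀ hd1 (by norm_num)
      rw [mul_assoc]
      gcongr)
    (by
      refine le_trans ?_ hKl
      have h1 : 8 * C₂ / c ^ 2 ≤ C₁ := by simp only [C₁]; linarith
      calc 8 * Real.log (H * (16 * d ^ 2 / c + 2) ^ d / (δ / 2)) * (d ^ 2 / c ^ 2)
          ≤ 8 * (C₂ * d * l) * (d ^ 2 / c ^ 2) := by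
            gcongr
            exact log_direction_covering_le hd hH hK0 hδ hδ1 hc
        _ = 8 * C₂ / c ^ 2 * (d ^ 3 * l) := by ring
        _ ≤ C₁ * (d ^ 3 * l) := by gcongr)
  refine ⟨E, hEm, hEp, fun D hD π hπ => ?_⟩
  have hmain : (⨆ π' : Policy S A, Mbar.value π' H 0 x₁) - Mbar.value π H 0 x₁ ≤ R := by
    refine (hEs D hD π hπ).trans ((accumulated_error_le hd hH hK0 hc (by linarith) hl1).trans ?_)
    rw [hR, mul_assoc C₁, mul_assoc C₁, mul_assoc C₁]
    have : C₀ ≤ C₁ := by simp only [C₁]; linarith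
    gcongr
  exact ⟨hmain, (M.subOpt_le p Mbar H x₁ π).trans (by linarith)⟩
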